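/- **Setting.** Let $G\subset SL_2(\mathbf C)$ be a finite subgroup and $\tau=\mathbf C^2$ its natural representation. Let $\Gamma$ be the affine A-D-E Dynkin graph corresponding to $G$: its vertex set $I$ indexes the irreducible complex representations $\pi_i$ of $G$ up to isomorphism, and the number of edges joining $i$ and $j$ is the multiplicity of $\pi_i$ in $\pi_j\otimes\tau$. Assume that $\Gamma$ has no loops and no multiple edges (i.e. $|G|\ge 3$). A *finite-dimensional double representation* of $\Gamma$ consists of a finite-dimensional complex vector space $V_i$ for each vertex $i$ and, for each edge $\{i,j\}$, two linear maps $x_{ij}:V_j\to V_i$ and $x_{ji}:V_i\to V_j$. Morphisms are families of linear maps $V_i\to V_i'$ commuting with all $x_{ij}$. For signs $\varepsilon_{ij}\in\{\pm1\}$ let $\mathcal R_\Gamma^{\varepsilon}$ be the category of finite-dimensional double representations satisfying, at every vertex $i$, $$\sum_j \varepsilon_{ij}\,x_{ij}x_{ji}=0 ,$$ the sum being over the neighbours $j$ of $i$. Let $\mathcal R_\Gamma$ be this category for $\varepsilon\equiv 1$, i.e. with the relations $\sum_j x_{ij}x_{ji}=0$. Let $\mathcal Coh_G(\tau)$ be the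 category of $G$-equivariant coherent sheaves on $\mathbf C^2=\operatorname{Spec}\mathbf C[x,y]$ whose space of global sections is finite-dimensional over $\mathbf C$. **Proposition 3.4.** 1. For every choice of signs with $\varepsilon_{ij}=-\varepsilon_{ji}$ on each edge $\{i,j\}$, the category $\mathcal R_\Gamma^{\varepsilon}$ is equivalent, as a $\mathbf C$-linear category, to $\mathcal Coh_G(\tau)$. 2. If $\Gamma$ is bipartite (that is, in every case except the cycles of odd length, which correspond to cyclic $G$ of odd order), then $\mathcal R_\Gamma$ itself is equivalent, as a $\mathbf C$-linear category, to $\mathcal Coh_G(\tau)$. -/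

import Mathlib

open CategoryTheory MonoidalCategory AlgebraicGeometry
open Scheme.Modules (pushforward pushforwardId pushforwardComp pushforwardCongr)
open scoped MatrixGroups

noncomputable section

/-! ## Double representations of a graph -/

section DoubleRepresentations

variable {I : Type*} (Γ : SimpleGraph I) [Γ.LocallyFinite] (ε : I → I → ℤˣ)

/-- A finite-dimensional double representation of the graph `Γ` over `ℂ`: a finite-dimensional space
at each vertex and a pair of operators `x i j : V j → V i`, `x j i : V i → V j` for each edge
`{i, j}`, such that `∑ j, ε i j • x i j ∘ x j i = 0` at each vertex `i`, where `j` runs through the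
neighbours of `i`. The signs `ε i j` are a parameter; for `ε = 1` the relation is the unsigned one,
`∑ j, x i j ∘ x j i = 0`. -/
structure DoubleRep where
  V : I → Type
  [addCommGroup : ∀ i, AddCommGroup (V i)]
  [module : ∀ i, Module ℂ (V i)]
  [finite : ∀ i, FiniteDimensional ℂ (V i)]
  x : ∀ i j, Γ.Adj i j → (V j →ₗ[ℂ] V i)
  relation : ∀ i, ∑ j : Γ.neighborSet i, ε i j • (x i j j.2 ∘ₗ x j i j.2.symm) = 0

attribute [instance] DoubleRep.addCommGroup DoubleRep.module DoubleRep.finite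

namespace DoubleRep

variable {Γ ε}

/-- A morphism of double representations: linear maps at the vertices that commute with all the
operators. -/
@[ext]
structure Hom (M N : DoubleRep Γ ε) where
  map : ∀ i, M.V i →ₗ[ℂ] N.V i
  comm : ∀ i j (h : Γ.Adj i j), map i ∘ₗ M.x i j h = N.x i j h ∘ₗ map j

instance : Category (DoubleRep Γ ε) where
  Hom := Hom
  id M := ⟨fun _ => LinearMap.id, fun _ _ _ => rfl⟩
  comp f g := ⟨fun i => g.map i ∘ₗ f.map i, fun i j h => by
    rw [LinearMap.comp_assoc, f.comm, ← LinearMap.comp_assoc, g.comm, LinearMap.comp_assoc]⟩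

@[ext]
theorem hom_ext {M N : DoubleRep Γ ε} {f g : M ⟶ N} (h : ∀ i, f.map i = g.map i) : f = g :=
  Hom.ext (funext h)

@[simp]
theorem comp_map {M N P : DoubleRep Γ ε} (f : M ⟶ N) (g : N ⟶ P) (i : I) :
    (f ≫ g).map i = g.map i ∘ₗ f.map i := rfl

section Operations

variable {M N : DoubleRep Γ ε}

instance : Add (M ⟶ N) where
  add f g := ⟨fun i => f.map i + g.map i, fun i j h => by
    rw [LinearMap.add_comp, f.comm, g.comm, LinearMap.comp_add]⟩

instance : Zero (M ⟶ N) where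
  zero := ⟨fun _ => 0, fun i j h => by rw [LinearMap.zero_comp, LinearMap.comp_zero]⟩

instance : Neg (M ⟶ N) where
  neg f := ⟨fun i => -f.map i, fun i j h => by
    rw [LinearMap.neg_comp, f.comm, LinearMap.comp_neg]⟩

instance : SMul ℂ (M ⟶ N) where
  smul c f := ⟨fun i => c • f.map i, fun i j h => by
    rw [LinearMap.smul_comp, f.comm, LinearMap.comp_smul]⟩

@[simp] theorem add_map (f g : M ⟶ N) (i : I) : (f + g).map i = f.map i + g.map i := rfl
@[simp] theorem zero_map (i : I) : (0 : M ⟶ N).map i = 0 := rfl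
@[simp] theorem neg_map (f : M ⟶ N) (i : I) : (-f).map i = -f.map i := rfl
@[simp] theorem smul_map (c : ℂ) (f : M ⟶ N) (i : I) : (c • f).map i = c • f.map i := rfl

instance : AddCommGroup (M ⟶ N) where
  add_assoc f g h := by ext1 i; exact add_assoc _ _ _
  zero_add f := by ext1 i; exact zero_add _
  add_zero f := by ext1 i; exact add_zero _
  add_comm f g := by ext1 i; exact add_comm _ _
  neg_add_cancel f := by ext1 i; exact neg_add_cancel _
  nsmul := nsmulRec
  zsmul := zsmulRec

instance : Module ℂ (M ⟶ N) where
  one_smul f := by ext1 i; exact one_smul _ _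
  mul_smul c d f := by ext1 i; exact mul_smul _ _ _
  smul_zero c := by ext1 i; exact smul_zero _
  smul_add c f g := by ext1 i; exact smul_add _ _ _
  add_smul c d f := by ext1 i; exact add_smul _ _ _
  zero_smul f := by ext1 i; exact zero_smul _ _

end Operations

instance : Preadditive (DoubleRep Γ ε) where
  add_comp M N P f g h := by ext1 i; exact LinearMap.comp_add _ _ _
  comp_add M N P f g h := by ext1 i; exact LinearMap.add_comp _ _ _

instance : Linear ℂ (DoubleRep Γ ε) where
  smul_comp M N P c f g := by ext1 i; exact LinearMap.comp_smul _ _ _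
  comp_smul M N P f c g := by ext1 i; exact LinearMap.smul_comp _ _ _

end DoubleRep

end DoubleRepresentations

/-! ## Sheaves of modules on the spectrum of a `ℂ`-algebra -/

section ComplexSheaves

variable {R : CommRingCat.{0}} [Algebra ℂ R]

instance sectionsModuleComplex (M : (Spec R).Modules) (U : (Spec R).Opens) : Module ℂ Γ(M, U) :=
  Module.compHom (R := R) Γ(M, U) (algebraMap ℂ R)

theorem sections_smul_def {M : (Spec R).Modules} {U : (Spec R).Opens} (c : ℂ) (s : Γ(M, U)) :
    c • s = algebraMap ℂ R c • s := rfl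

theorem sections_app_smul {M N : (Spec R).Modules} (f : M ⟶ N) (U : (Spec R).Opens) (c : ℂ)
    (s : Γ(M, U)) : f.app U (c • s) = c • f.app U s := by
  rw [sections_smul_def, sections_smul_def, Scheme.Modules.smul_Spec_def,
    Scheme.Modules.smul_Spec_def, Scheme.Modules.Hom.app_smul]

theorem sections_smul_smul {M : (Spec R).Modules} (U : (Spec R).Opens) (c : ℂ)
    (r : Γ(Spec R, U)) (s : Γ(M, U)) : c • r • s = r • c • s := by
  rw [sections_smul_def, sections_smul_def, Scheme.Modules.smul_Spec_def,
    Scheme.Modules.smul_Spec_def, smul_smul, smul_smul, mul_comm]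

/-- Multiplication by a scalar, as an endomorphism of a sheaf of modules. -/
def scalarEnd (M : (Spec R).Modules) (c : ℂ) : M ⟶ M :=
  ⟨{ app U := ModuleCat.ofHom (X := M.val.obj U) (Y := M.val.obj U)
      { toFun s := show Γ(M, U.unop) from c • (show Γ(M, U.unop) from s)
        map_add' s t := smul_add c (show Γ(M, U.unop) from s) (show Γ(M, U.unop) from t)
        map_smul' r s := sections_smul_smul U.unop c r s }
     naturality {U V} i := by
      ext s
      exact (Scheme.Modules.map_smul_Spec (M := M) (U := V.unop) (V := U.unop) i
        (algebraMap ℂ R c) s).symm }⟩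

instance : Linear ℂ (Spec R).Modules where
  homModule M N :=
    { smul c f := f ≫ scalarEnd N c
      one_smul f := by ext U s; exact one_smul ℂ (f.app U s)
      mul_smul c d f := by ext U s; exact mul_smul c d (f.app U s)
      smul_zero c := Limits.zero_comp
      smul_add c f g := Preadditive.add_comp ..
      add_smul c d f := by ext U s; exact add_smul c d (f.app U s)
      zero_smul f := by ext U s; exact zero_smul ℂ (f.app U s) }
  smul_comp M N K c f g := by ext U s; exact sections_app_smul g U c (f.app U s)
  comp_smul M N K f c g := (Category.assoc ..).symm

theorem smul_app {M N : (Spec R).Modules} (c : ℂ) (f : M ⟶ N) (U : (Spec R).Opens)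
    (s : Γ(M, U)) : (c • f).app U s = c • f.app U s := rfl

theorem pushforward_sections_smul {φ : R ⟶ R} (hφ : ∀ c : ℂ, φ (algebraMap ℂ R c) = algebraMap ℂ R c)
    (M : (Spec R).Modules) (U : (Spec R).Opens) (c : ℂ) (s : Γ(M, (Spec.map φ) ⁻¹ᵁ U)) :
    (show Γ((pushforward (Spec.map φ)).obj M, U) from c • s) =
      c • (show Γ((pushforward (Spec.map φ)).obj M, U) from s) := by
  have key : (Spec.map φ).app U ((Spec R).presheaf.map U.leTop.op
      ((Scheme.ΓSpecIso R).inv (algebraMap ℂ R c))) =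
      (Spec R).presheaf.map ((Spec.map φ) ⁻¹ᵁ U).leTop.op
        ((Scheme.ΓSpecIso R).inv (algebraMap ℂ R c)) := by
    conv_rhs => rw [← hφ c]
    simp only [← CategoryTheory.comp_apply]
    congr 2
    simp
    rfl
  rw [sections_smul_def, sections_smul_def, Scheme.Modules.smul_Spec_def,
    Scheme.Modules.smul_Spec_def]
  exact congrArg (fun r : Γ(Spec R, (Spec.map φ) ⁻¹ᵁ U) => r • s) key.symm

theorem pushforward_map_smul {φ : R ⟶ R} (hφ : ∀ c : ℂ, φ (algebraMap ℂ R c) = algebraMap ℂ R c)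
    {M N : (Spec R).Modules} (c : ℂ) (f : M ⟶ N) :
    (pushforward (Spec.map φ)).map (c • f) = c • (pushforward (Spec.map φ)).map f := by
  ext U s
  exact pushforward_sections_smul hφ N U c (f.app _ s)

end ComplexSheaves

/-! ## Equivariant coherent sheaves on the affine plane -/

/-- The affine plane `ℂ²` as a scheme, `Spec ℂ[x, y]`. -/
abbrev AffinePlane : Scheme.{0} := Spec (CommRingCat.of (MvPolynomial (Fin 2) ℂ))

/-- The substitution `f ↦ f ∘ g` on polynomial functions on `ℂ²`, for `g ∈ SL₂(ℂ)`. -/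
def polyComp (g : SL(2, ℂ)) : MvPolynomial (Fin 2) ℂ →ₐ[ℂ] MvPolynomial (Fin 2) ℂ :=
  MvPolynomial.aeval fun i => ∑ j, MvPolynomial.C (g.1 i j) * MvPolynomial.X j

theorem polyComp_one : polyComp 1 = AlgHom.id ℂ _ := by
  ext i : 1
  simp [polyComp, Matrix.one_apply]

theorem polyComp_mul (g h : SL(2, ℂ)) : polyComp (g * h) = (polyComp h).comp (polyComp g) := by
  ext i : 1
  fin_cases i <;> simp [polyComp, Matrix.mul_apply, Fin.sum_univ_two] <;> ring

/-- The automorphism `v ↦ g v` of the affine plane. -/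
def planeMap (g : SL(2, ℂ)) : AffinePlane ⟶ AffinePlane :=
  Spec.map (CommRingCat.ofHom (polyComp g).toRingHom)

theorem planeMap_one : planeMap 1 = 𝟙 AffinePlane := by
  rw [planeMap, polyComp_one]
  exact Spec.map_id _

theorem planeMap_mul (g h : SL(2, ℂ)) : planeMap (g * h) = planeMap h ≫ planeMap g := by
  rw [planeMap, polyComp_mul, planeMap, planeMap, ← Spec.map_comp]
  rfl

theorem planeMap_smul (g : SL(2, ℂ)) {M N : AffinePlane.Modules} (c : ℂ) (f : M ⟶ N) :
    (pushforward (planeMap g)).map (c • f) = c • (pushforward (planeMap g)).map f :=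
  pushforward_map_smul (fun a => (polyComp g).commutes a) c f

/-- A `G`-equivariant sheaf of modules on the affine plane: a sheaf of modules `F` with morphisms
`F ⟶ g_* F` (equivalently `g^* F ⟶ F`), for `g ∈ G`, which are the identity for `g = 1` and satisfy
the cocycle condition for products; by these two conditions they are isomorphisms. On sections over
`U` the morphism is `s ↦ g⁻¹ s`, from `F(U)` to `F(g⁻¹ U)`. -/
structure EquivariantSheaf (G : Subgroup SL(2, ℂ)) where
  sheaf : AffinePlane.Modules
  lin : ∀ g : G, sheaf ⟶ (pushforward (planeMap g)).obj sheaf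
  lin_one : lin 1 = (pushforwardId AffinePlane).inv.app sheaf ≫
    (pushforwardCongr planeMap_one.symm).hom.app sheaf
  lin_mul : ∀ g h : G, lin (g * h) = lin g ≫ (pushforward (planeMap g)).map (lin h) ≫
    (pushforwardComp (planeMap h) (planeMap g)).hom.app sheaf ≫
      (pushforwardCongr (planeMap_mul g h).symm).hom.app sheaf

namespace EquivariantSheaf

variable {G : Subgroup SL(2, ℂ)}

/-- A morphism of equivariant sheaves: a morphism of sheaves of modules that commutes with `G`. -/
@[ext]
structure Hom (E F : EquivariantSheaf G) where
  hom : E.sheaf ⟶ F.sheaf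
  comm : ∀ g : G, E.lin g ≫ (pushforward (planeMap g)).map hom = hom ≫ F.lin g

instance : Category (EquivariantSheaf G) where
  Hom := Hom
  id E := ⟨𝟙 _, fun g => by simp⟩
  comp f f' := ⟨f.hom ≫ f'.hom, fun g => by
    rw [Functor.map_comp, ← Category.assoc, f.comm, Category.assoc, f'.comm, Category.assoc]⟩

@[ext]
theorem hom_ext {E F : EquivariantSheaf G} {f f' : E ⟶ F} (h : f.hom = f'.hom) : f = f' :=
  Hom.ext h

@[simp]
theorem comp_hom {E F H : EquivariantSheaf G} (f : E ⟶ F) (f' : F ⟶ H) :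
    (f ≫ f').hom = f.hom ≫ f'.hom := rfl

section Operations

variable {E F : EquivariantSheaf G}

instance : Add (E ⟶ F) where
  add f f' := ⟨f.hom + f'.hom, fun g => by
    rw [Functor.map_add, Preadditive.comp_add, f.comm, f'.comm, Preadditive.add_comp]⟩

instance : Zero (E ⟶ F) where
  zero := ⟨0, fun g => by rw [Functor.map_zero, Limits.comp_zero, Limits.zero_comp]⟩

instance : Neg (E ⟶ F) where
  neg f := ⟨-f.hom, fun g => by
    rw [Functor.map_neg, Preadditive.comp_neg, f.comm, Preadditive.neg_comp]⟩

instance : SMul ℂ (E ⟶ F) where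
  smul c f := ⟨c • f.hom, fun g => by
    rw [planeMap_smul, Linear.comp_smul, Linear.smul_comp]
    exact congrArg (c • ·) (f.comm g)⟩

@[simp] theorem add_hom (f f' : E ⟶ F) : (f + f').hom = f.hom + f'.hom := rfl
@[simp] theorem zero_hom : (0 : E ⟶ F).hom = 0 := rfl
@[simp] theorem neg_hom (f : E ⟶ F) : (-f).hom = -f.hom := rfl
@[simp] theorem smul_hom (c : ℂ) (f : E ⟶ F) : (c • f).hom = c • f.hom := rfl

instance : AddCommGroup (E ⟶ F) where
  add_assoc f g h := by ext1; exact add_assoc _ _ _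
  zero_add f := by ext1; exact zero_add _
  add_zero f := by ext1; exact add_zero _
  add_comm f g := by ext1; exact add_comm _ _
  neg_add_cancel f := by ext1; exact neg_add_cancel _
  nsmul := nsmulRec
  zsmul := zsmulRec

instance : Module ℂ (E ⟶ F) where
  one_smul f := by ext1; exact one_smul _ _
  mul_smul c d f := by ext1; exact mul_smul _ _ _
  smul_zero c := by ext1; exact smul_zero _
  smul_add c f g := by ext1; exact smul_add _ _ _
  add_smul c d f := by ext1; exact add_smul _ _ _
  zero_smul f := by ext1; exact zero_smul _ _

end Operations

instance : Preadditive (EquivariantSheaf G) where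
  add_comp E F H f f' h := by ext1; exact Preadditive.add_comp _ _ _ _ _ _
  comp_add E F H f h h' := by ext1; exact Preadditive.comp_add _ _ _ _ _ _

instance : Linear ℂ (EquivariantSheaf G) where
  smul_comp E F H c f f' := by ext1; exact Linear.smul_comp _ _ _ _ _ _
  comp_smul E F H f c f' := by ext1; exact Linear.comp_smul _ _ _ _ _ _

end EquivariantSheaf

/-- The equivariant sheaves on `ℂ²` that are coherent (on this Noetherian scheme: quasi-coherent of
finite type) and whose space of global sections is finite-dimensional over `ℂ`. -/
def isFiniteCoherent (G : Subgroup SL(2, ℂ)) : ObjectProperty (EquivariantSheaf G) := fun E =>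
  E.sheaf.IsQuasicoherent ∧ E.sheaf.IsFiniteType ∧ FiniteDimensional ℂ Γ(E.sheaf, ⊤)

/-- The category of `G`-equivariant coherent sheaves on `ℂ²` with finite-dimensional space of global
sections. -/
abbrev CohPlane (G : Subgroup SL(2, ℂ)) := (isFiniteCoherent G).FullSubcategory

/-! ## The graph of a finite subgroup of `SL₂(ℂ)` -/

/-- The natural representation of `G ⊆ SL₂(ℂ)` on `ℂ²`. -/
def naturalRep (G : Subgroup SL(2, ℂ)) : FDRep ℂ G :=
  FDRep.of (V := Fin 2 → ℂ)
    { toFun g := Matrix.toLin' g.1.1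
      map_one' := Matrix.toLin'_one
      map_mul' g h := Matrix.toLin'_mul g.1.1 h.1.1 }

/-- `Γ` is the graph of `G` in the McKay correspondence, with the irreducible representation `π i`
at the vertex `i`: every irreducible representation of `G` sits at exactly one vertex, and the
number of edges (`0` or `1`) between `i` and `j` is the multiplicity of `π i` in the tensor product
of `π j` with the natural representation. -/
structure IsMcKayGraph (G : Subgroup SL(2, ℂ)) {I : Type*} (Γ : SimpleGraph I) [DecidableRel Γ.Adj]
    (π : I → FDRep ℂ G) : Prop where
  simple : ∀ i, Simple (π i)
  injective : ∀ i j, Nonempty (π i ≅ π j) → i = j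
  surjective : ∀ ρ : FDRep ℂ G, Simple ρ → ∃ i, Nonempty (ρ ≅ π i)
  multiplicity : ∀ i j,
    Module.finrank ℂ (π i ⟶ π j ⊗ naturalRep G) = if Γ.Adj i j then 1 else 0

end

/-! Both categories are identified with finite-dimensional modules over the skew group algebra `ℂ[x,
y] ⋊ G`: a space `W` with a `G`-action and two commuting operators that `G` transforms like the
coordinates of the plane. On the sheaf side, the plane is affine, so quasi-coherent sheaves, their
morphisms and their linearizations are determined by global sections. On the graph side, complete
reducibility gives `W ≅ ⨁ π i ⊗ V i`. The pair of coordinate operators is an equivariant map `W → W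
⊗ ℂ²`. Since `Hom_G(π j, π i ⊗ ℂ²)` is a line when `i` and `j` are joined and zero otherwise,
choosing generators `φ i j` makes such a pair the same as operators `V j → V i` along the edges
(`exists_eq_coord`). It remains to translate commutativity of the coordinates. The commutator is the
composite contracted with the symplectic form of `ℂ²`, which is `G`-invariant because `det g = 1`.
Hence the contraction of `φ i j` with `φ j k` is an intertwiner `π k → π i`: by Schur it is zero for
`i ≠ k` and a scalar for `i = k`. The traces of these scalars on the two sides of an edge are
opposite, since the form is alternating, and nonzero, by averaging over `G`. Rescaling the
generators therefore realizes every prescribed family of signs antisymmetric along edges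
(`exists_spanningPairs`), and commutativity becomes the relation at each vertex (`commute_iff`). A
nonzero factor at a vertex does not change the relation there, so it is enough that `u i * ε i j` be
antisymmetric for some signs `u i`. For antisymmetric `ε` take `u = 1`; for `ε = 1` on a bipartite
graph take `u` to be the two-colouring. -/

open scoped TensorProduct

universe u v w

noncomputable section

/-! ### Quasi-coherent sheaves on an affine scheme and their global sections. -/

section GlobalSections

variable {R : CommRingCat.{0}}

/-- The adjunction between `tilde` and global sections, combined with the counit at `M`, which is
invertible as `M` is quasi-coherent. Only the source has to be quasi-coherent, so `N` may be a
direct image without further argument. -/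
theorem moduleSpecΓFunctor_map_bijective (M N : (Spec R).Modules) [M.IsQuasicoherent] :
    Function.Bijective fun f : M ⟶ N => (moduleSpecΓFunctor (R := R)).map f := by
  have h : (fun f : M ⟶ N => (moduleSpecΓFunctor (R := R)).map f) =
      (tilde.adjunction (R := R).homEquiv _ N) ∘
        fun f => tilde.adjunction (R := R).counit.app M ≫ f := by
    funext f
    simp [Adjunction.homEquiv_unit]
  rw [h]
  refine (Equiv.bijective _).comp ?_
  have : IsIso (tilde.adjunction (R := R).counit.app M) :=
    Scheme.Modules.isIso_fromTildeΓ_of_isQuasicoherent M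
  exact ((asIso (tilde.adjunction (R := R).counit.app M)).homFromEquiv (Z := N)).symm.bijective

theorem hom_ext_of_isQuasicoherent {M N : (Spec R).Modules} [M.IsQuasicoherent] {f g : M ⟶ N}
    (h : ∀ s : Γ(M, ⊤), f.app ⊤ s = g.app ⊤ s) : f = g :=
  (moduleSpecΓFunctor_map_bijective M N).1 (ModuleCat.hom_ext (LinearMap.ext h))

theorem exists_hom_of_isQuasicoherent {M N : (Spec R).Modules} [M.IsQuasicoherent]
    (φ : Γ(M, ⊤) →ₗ[R] Γ(N, ⊤)) : ∃ f : M ⟶ N, ∀ s : Γ(M, ⊤), f.app ⊤ s = φ s := by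
  obtain ⟨f, hf⟩ := (moduleSpecΓFunctor_map_bijective M N).2 (ModuleCat.ofHom (R := R) (X := Γ(M, ⊤)) (Y := Γ(N, ⊤)) φ)
  exact ⟨f, fun s => congr($hf s)⟩

theorem isFiniteType_tilde (M : ModuleCat R) [Module.Finite R M] :
    (tilde M).IsFiniteType := by
  obtain ⟨s, hs⟩ := Module.Finite.fg_top (R := R) (M := M)
  let p := presentationTilde M (s : Set M) hs _ (Submodule.span_eq _)
  have : p.generators.IsFiniteType := ⟨inferInstanceAs (Finite (s : Set M))⟩
  exact ⟨p.generators.localGeneratorsData, ⟨fun _ => ⟨this.finite⟩⟩⟩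

def tildeTop (M : ModuleCat R) : M ≃ₗ[R] Γ(tilde M, ⊤) := (tilde.isoTop M).toLinearEquiv

/-- The two sides live on the same group of sections with two different `R`-actions; this is what
makes a morphism to a direct image semilinear along `φ` on global sections. -/
theorem pushforward_smul (φ : R ⟶ R) (M : (Spec R).Modules) (r : R) (s : Γ(M, ⊤)) :
    (r • (show Γ((pushforward (Spec.map φ)).obj M, ⊤) from s)) =
    (show Γ((pushforward (Spec.map φ)).obj M, ⊤) from φ r • s) := by
  have key : (Spec.map φ).app ⊤ ((Spec R).presheaf.map (⊤ : (Spec R).Opens).leTop.op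
      ((Scheme.ΓSpecIso R).inv r)) =
      (Spec R).presheaf.map (⊤ : (Spec R).Opens).leTop.op
        ((Scheme.ΓSpecIso R).inv (φ r)) := by
    simp only [← CategoryTheory.comp_apply]
    congr 2
    simp
    rfl
  rw [Scheme.Modules.smul_Spec_def, Scheme.Modules.smul_Spec_def]
  exact congrArg (fun r : Γ(Spec R, ⊤) => r • s) key
end GlobalSections

/-! ### Modules over the skew group algebra. -/

section EquivariantPairs

variable {G : Subgroup SL(2, ℂ)} {P Q : Type*} [AddCommGroup P] [Module ℂ P] [AddCommGroup Q]
  [Module ℂ Q]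

/-- Pairs of linear maps that `G` transforms like the coordinate functions of `ℂ²`. -/
def equivariantPairs (ρ : Representation ℂ G P) (σ : Representation ℂ G Q) :
    Submodule ℂ (Fin 2 → P →ₗ[ℂ] Q) where
  carrier := {f | ∀ g a, σ g ∘ₗ f a = ∑ b, (g⁻¹ : G).1.1 a b • (f b ∘ₗ ρ g)}
  add_mem' {f f'} hf hf' g a := by
    simp [LinearMap.comp_add, LinearMap.add_comp, hf g a, hf' g a]
    abel
  zero_mem' g a := by simp
  smul_mem' c f hf g a := by
    simp [LinearMap.comp_smul, LinearMap.smul_comp, hf g a, smul_comm c]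

theorem mem_equivariantPairs {ρ : Representation ℂ G P} {σ : Representation ℂ G Q}
    {f : Fin 2 → P →ₗ[ℂ] Q} : f ∈ equivariantPairs ρ σ ↔
      ∀ g a, σ g ∘ₗ f a = ∑ b, (g⁻¹ : G).1.1 a b • (f b ∘ₗ ρ g) := Iff.rfl

end EquivariantPairs

/-- A finite-dimensional module over the skew group algebra `ℂ[x, y] ⋊ G`. -/
structure SkewModule (G : Subgroup SL(2, ℂ)) where
  W : Type u
  [addCommGroup : AddCommGroup W]
  [module : Module ℂ W]
  [finite : FiniteDimensional ℂ W]
  ρ : Representation ℂ G W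
  X : Fin 2 → W →ₗ[ℂ] W
  commute : X 0 ∘ₗ X 1 = X 1 ∘ₗ X 0
  equivariant : X ∈ equivariantPairs ρ ρ

attribute [instance] SkewModule.addCommGroup SkewModule.module SkewModule.finite

namespace SkewModule

variable {G : Subgroup SL(2, ℂ)}

/-- A morphism of modules over the skew group algebra. -/
@[ext]
structure Hom (M N : SkewModule.{u} G) where
  lin : M.W →ₗ[ℂ] N.W
  comm_ρ : ∀ g, lin ∘ₗ M.ρ g = N.ρ g ∘ₗ lin
  comm_X : ∀ a, lin ∘ₗ M.X a = N.X a ∘ₗ lin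

instance : Category (SkewModule.{u} G) where
  Hom := Hom
  id M := ⟨LinearMap.id, fun _ => rfl, fun _ => rfl⟩
  comp f g := ⟨g.lin ∘ₗ f.lin,
    fun i => by rw [LinearMap.comp_assoc, f.comm_ρ, ← LinearMap.comp_assoc, g.comm_ρ,
      LinearMap.comp_assoc],
    fun i => by rw [LinearMap.comp_assoc, f.comm_X, ← LinearMap.comp_assoc, g.comm_X,
      LinearMap.comp_assoc]⟩

@[ext]
theorem hom_ext {M N : SkewModule.{u} G} {f g : M ⟶ N} (h : f.lin = g.lin) : f = g :=
  Hom.ext h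

@[simp] theorem id_lin (M : SkewModule.{u} G) : Hom.lin (𝟙 M) = LinearMap.id := rfl

@[simp]
theorem comp_lin {M N P : SkewModule.{u} G} (f : M ⟶ N) (g : N ⟶ P) :
    (f ≫ g).lin = g.lin ∘ₗ f.lin := rfl

section Operations

variable {M N : SkewModule.{u} G}

instance : Add (M ⟶ N) where
  add f g := ⟨f.lin + g.lin,
    fun i => by rw [LinearMap.add_comp, f.comm_ρ, g.comm_ρ, LinearMap.comp_add],
    fun i => by rw [LinearMap.add_comp, f.comm_X, g.comm_X, LinearMap.comp_add]⟩

instance : Zero (M ⟶ N) where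
  zero := ⟨0, fun i => by rw [LinearMap.zero_comp, LinearMap.comp_zero],
    fun i => by rw [LinearMap.zero_comp, LinearMap.comp_zero]⟩

instance : Neg (M ⟶ N) where
  neg f := ⟨-f.lin, fun i => by rw [LinearMap.neg_comp, f.comm_ρ, LinearMap.comp_neg],
    fun i => by rw [LinearMap.neg_comp, f.comm_X, LinearMap.comp_neg]⟩

instance : SMul ℂ (M ⟶ N) where
  smul c f := ⟨c • f.lin, fun i => by rw [LinearMap.smul_comp, f.comm_ρ, LinearMap.comp_smul],
    fun i => by rw [LinearMap.smul_comp, f.comm_X, LinearMap.comp_smul]⟩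

@[simp] theorem add_lin (f g : M ⟶ N) : (f + g).lin = f.lin + g.lin := rfl
@[simp] theorem zero_lin : (0 : M ⟶ N).lin = 0 := rfl
@[simp] theorem neg_lin (f : M ⟶ N) : (-f).lin = -f.lin := rfl
@[simp] theorem smul_lin (c : ℂ) (f : M ⟶ N) : (c • f).lin = c • f.lin := rfl

instance : AddCommGroup (M ⟶ N) where
  add_assoc f g h := by ext1; exact add_assoc _ _ _
  zero_add f := by ext1; exact zero_add _
  add_zero f := by ext1; exact add_zero _
  add_comm f g := by ext1; exact add_comm _ _
  neg_add_cancel f := by ext1; exact neg_add_cancel _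
  nsmul := nsmulRec
  zsmul := zsmulRec

instance : Module ℂ (M ⟶ N) where
  one_smul f := by ext1; exact one_smul _ _
  mul_smul c d f := by ext1; exact mul_smul _ _ _
  smul_zero c := by ext1; exact smul_zero _
  smul_add c f g := by ext1; exact smul_add _ _ _
  add_smul c d f := by ext1; exact add_smul _ _ _
  zero_smul f := by ext1; exact zero_smul _ _

end Operations

instance : Preadditive (SkewModule.{u} G) where
  add_comp M N P f g h := by ext1; exact LinearMap.comp_add _ _ _
  comp_add M N P f g h := by ext1; exact LinearMap.add_comp _ _ _

instance : Linear ℂ (SkewModule.{u} G) where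
  smul_comp M N P c f g := by ext1; exact LinearMap.comp_smul _ _ _
  comp_smul M N P f c g := by ext1; exact LinearMap.smul_comp _ _ _

/-- A bijective linear map that commutes with the operators is an isomorphism. -/
def isoMk {M N : SkewModule.{u} G} (e : M.W ≃ₗ[ℂ] N.W) (hρ : ∀ g w, e (M.ρ g w) = N.ρ g (e w))
    (hX : ∀ a w, e (M.X a w) = N.X a (e w)) : M ≅ N where
  hom := ⟨e, fun g => LinearMap.ext (hρ g), fun a => LinearMap.ext (hX a)⟩
  inv := ⟨e.symm, fun g => LinearMap.ext fun w => by simp [LinearEquiv.symm_apply_eq, hρ],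
    fun a => LinearMap.ext fun w => by simp [LinearEquiv.symm_apply_eq, hX]⟩
  hom_inv_id := by ext w; exact e.symm_apply_apply w
  inv_hom_id := by ext w; exact e.apply_symm_apply w

/-- The structure on `W` obtained from that on `M` along a linear equivalence. -/
@[simps W]
def transport (M : SkewModule.{u} G) {W : Type v} [AddCommGroup W] [Module ℂ W]
    (e : M.W ≃ₗ[ℂ] W) : SkewModule.{v} G :=
  have : FiniteDimensional ℂ W := Module.Finite.equiv e
  { W := W
    ρ :=
      { toFun g := e.conj (M.ρ g)
        map_one' := by ext w; simp
        map_mul' g h := by ext w; simp }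
    X a := e.conj (M.X a)
    commute := by
      ext w
      simpa using congr($M.commute (e.symm w))
    equivariant g a := by
      ext w
      simpa [-Fin.sum_univ_two] using congr(e ($(M.equivariant g a) (e.symm w))) }

section Transport

variable (M : SkewModule.{u} G) {W : Type v} [AddCommGroup W] [Module ℂ W] (e : M.W ≃ₗ[ℂ] W)

theorem transport_ρ_apply (g : G) (w : M.W) : (M.transport e).ρ g (e w) = e (M.ρ g w) := by
  change e.conj (M.ρ g) (e w) = _
  simp

theorem transport_X_apply (a : Fin 2) (w : M.W) : (M.transport e).X a (e w) = e (M.X a w) := by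
  change e.conj (M.X a) (e w) = _
  simp

end Transport

variable (G) in
/-- The passage to a larger universe. -/
def uliftFunctor : SkewModule.{0} G ⥤ SkewModule.{u} G where
  obj M := M.transport (W := ULift.{u} M.W) ULift.moduleEquiv.symm
  map {M N} f :=
    { lin := ULift.moduleEquiv.symm.toLinearMap ∘ₗ f.lin ∘ₗ ULift.moduleEquiv.toLinearMap
      comm_ρ g := by
        ext w
        exact congr(ULift.up ($(f.comm_ρ g) w.down))
      comm_X a := by
        ext w
        exact congr(ULift.up ($(f.comm_X a) w.down)) }

instance : (uliftFunctor.{u} G).Additive where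
instance : (uliftFunctor.{u} G).Linear ℂ where

instance : (uliftFunctor.{u} G).Faithful where
  map_injective {M N} f g h := by
    ext w
    exact congr(ULift.down ($(congrArg Hom.lin h) (ULift.up w)))

instance : (uliftFunctor.{u} G).Full where
  map_surjective {M N} f := by
    refine ⟨⟨ULift.moduleEquiv.toLinearMap ∘ₗ f.lin ∘ₗ ULift.moduleEquiv.symm.toLinearMap,
      fun g => ?_, fun a => ?_⟩, rfl⟩
    · ext w
      exact congr(ULift.down ($(f.comm_ρ g) (ULift.up w)))
    · ext w
      exact congr(ULift.down ($(f.comm_X a) (ULift.up w)))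

instance : (uliftFunctor.{u} G).EssSurj where
  mem_essImage N := by
    -- A basis replaces the space, which may live in a large universe, by some `ℂⁿ`.
    let e := (Module.finBasis ℂ N.W).equivFun
    refine ⟨N.transport e, ⟨isoMk (ULift.moduleEquiv.trans e.symm) ?_ ?_⟩⟩
    · rintro g ⟨w⟩
      obtain ⟨w, rfl⟩ := e.surjective w
      exact (congrArg e.symm (N.transport_ρ_apply e g w)).trans
        ((e.symm_apply_apply _).trans (congrArg (N.ρ g) (e.symm_apply_apply w).symm))
    · rintro a ⟨w⟩
      obtain ⟨w, rfl⟩ := e.surjective w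
      exact (congrArg e.symm (N.transport_X_apply e a w)).trans
        ((e.symm_apply_apply _).trans (congrArg (N.X a) (e.symm_apply_apply w).symm))

instance : (uliftFunctor.{u} G).IsEquivalence where

end SkewModule

/-! ### Equivariant coherent sheaves as modules over the skew group algebra. -/

section TopMap

variable {X : Scheme.{0}} {M N : X.Modules}

/-- The map on global sections induced by a morphism to a direct image. -/
def topMap {f : X ⟶ X} (a : M ⟶ (pushforward f).obj N) : Γ(M, ⊤) →+ Γ(N, ⊤) :=
  (a.app ⊤).hom

theorem topMap_id {f : X ⟶ X} (hf : 𝟙 X = f) (s : Γ(M, ⊤)) :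
    topMap ((pushforwardId X).inv.app M ≫ (pushforwardCongr hf).hom.app M) s = s := by
  subst hf
  exact congr($(M.presheaf.map_id _) s)

theorem topMap_comp {f g h : X ⟶ X} (hh : f ≫ g = h) (a : M ⟶ (pushforward g).obj M)
    (b : M ⟶ (pushforward f).obj M) (s : Γ(M, ⊤)) :
    topMap (a ≫ (pushforward g).map b ≫ (pushforwardComp f g).hom.app M ≫
      (pushforwardCongr hh).hom.app M) s = topMap b (topMap a s) := by
  subst hh
  exact congr($(M.presheaf.map_id _) _)

end TopMap

theorem topMap_smul {R : CommRingCat.{0}} {φ : R ⟶ R} {M N : (Spec R).Modules}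
    (a : M ⟶ (pushforward (Spec.map φ)).obj N) (r : R) (s : Γ(M, ⊤)) :
    topMap a (r • s) = φ r • topMap a s :=
  (a.app_smul _ _).trans (pushforward_smul φ N r _)

theorem topMap_injective {R : CommRingCat.{0}} {φ : R ⟶ R} {M N : (Spec R).Modules}
    [M.IsQuasicoherent] {a b : M ⟶ (pushforward (Spec.map φ)).obj N} (h : topMap a = topMap b) :
    a = b :=
  hom_ext_of_isQuasicoherent fun s => DFunLike.congr_fun h s

theorem exists_topMap_eq {R : CommRingCat.{0}} {φ : R ⟶ R} {M N : (Spec R).Modules}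
    [M.IsQuasicoherent] (L : Γ(M, ⊤) →+ Γ(N, ⊤)) (hL : ∀ (r : R) s, L (r • s) = φ r • L s) :
    ∃ a : M ⟶ (pushforward (Spec.map φ)).obj N, topMap a = L := by
  let L' : Γ(M, ⊤) →ₗ[R] Γ((pushforward (Spec.map φ)).obj N, ⊤) :=
    { toFun := L
      map_add' := L.map_add
      map_smul' r s := (hL r s).trans (pushforward_smul φ N r (L s)).symm }
  obtain ⟨a, ha⟩ := exists_hom_of_isQuasicoherent L'
  exact ⟨a, AddMonoidHom.ext ha⟩

section AffinePlane

variable (M : AffinePlane.Modules) (U : AffinePlane.Opens)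

instance sectionsModulePolynomial : Module (MvPolynomial (Fin 2) ℂ) Γ(M, U) :=
  Scheme.Modules.instModuleCarrierCarrierObjOppositeOpensCarrierCarrierCommRingCatSpecAbPresheafOp
    (R := CommRingCat.of (MvPolynomial (Fin 2) ℂ))

instance : IsScalarTower ℂ (MvPolynomial (Fin 2) ℂ) Γ(M, U) :=
  IsScalarTower.of_algebraMap_smul fun _ _ => rfl

end AffinePlane

namespace EquivariantSheaf

variable {G : Subgroup SL(2, ℂ)} (E : EquivariantSheaf G)

/-- The action `s ↦ g⁻¹ s` on global sections. -/
def linTop (g : G) : Γ(E.sheaf, ⊤) →+ Γ(E.sheaf, ⊤) := topMap (E.lin g)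

theorem linTop_smul (g : G) (r : MvPolynomial (Fin 2) ℂ) (s : Γ(E.sheaf, ⊤)) :
    E.linTop g (r • s) = polyComp g.1 r • E.linTop g s :=
  topMap_smul (φ := CommRingCat.ofHom (polyComp g.1).toRingHom) (E.lin g) r s

theorem linTop_one (s : Γ(E.sheaf, ⊤)) : E.linTop 1 s = s := by
  rw [linTop, E.lin_one]
  exact topMap_id planeMap_one.symm s

/-- The order is reversed because `linTop g` is the action of `g⁻¹`; the representation on global
sections is therefore `g ↦ linTop g⁻¹`. -/
theorem linTop_mul (g h : G) (s : Γ(E.sheaf, ⊤)) :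
    E.linTop (g * h) s = E.linTop h (E.linTop g s) := by
  rw [linTop, E.lin_mul]
  exact topMap_comp (planeMap_mul g.1 h.1).symm (E.lin g) (E.lin h) s

end EquivariantSheaf

section PolynomialLinearity

variable {A B : Type*} [AddCommGroup A] [Module ℂ A] [AddCommGroup B] [Module ℂ B]
  [Module (MvPolynomial (Fin 2) ℂ) A] [IsScalarTower ℂ (MvPolynomial (Fin 2) ℂ) A]
  [Module (MvPolynomial (Fin 2) ℂ) B] [IsScalarTower ℂ (MvPolynomial (Fin 2) ℂ) B]

theorem map_polynomial_smul (L : A →ₗ[ℂ] B)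
    (hL : ∀ i s, L ((MvPolynomial.X i : MvPolynomial (Fin 2) ℂ) • s) =
      (MvPolynomial.X i : MvPolynomial (Fin 2) ℂ) • L s)
    (r : MvPolynomial (Fin 2) ℂ) (s : A) : L (r • s) = r • L s := by
  induction r using MvPolynomial.induction_on generalizing s with
  | C c =>
    rw [← MvPolynomial.algebraMap_eq, algebraMap_smul, algebraMap_smul, map_smul]
  | add p q hp hq => rw [add_smul, add_smul, map_add, hp, hq]
  | mul_X p i hp => rw [mul_smul, mul_smul, hp, hL]

end PolynomialLinearity

section GlobalSectionsFunctor

variable (G : Subgroup SL(2, ℂ))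

/-- Global sections of equivariant coherent sheaves, as modules over the skew group algebra. -/
def globalSections : CohPlane G ⥤ SkewModule.{0} G where
  obj E :=
    have : FiniteDimensional ℂ Γ(E.obj.sheaf, ⊤) := E.property.2.2
    { W := Γ(E.obj.sheaf, ⊤)
      ρ :=
        { toFun g :=
            { toFun := E.obj.linTop g⁻¹
              map_add' := map_add _
              map_smul' c s := by
                rw [← algebraMap_smul (MvPolynomial (Fin 2) ℂ) c s, E.obj.linTop_smul,
                  AlgHom.commutes, algebraMap_smul, RingHom.id_apply] }
          map_one' := by
            ext s
            simpa using E.obj.linTop_one s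
          map_mul' g h := by
            ext s
            simpa using E.obj.linTop_mul h⁻¹ g⁻¹ s }
      X a := Algebra.lsmul ℂ ℂ Γ(E.obj.sheaf, ⊤) (MvPolynomial.X a : MvPolynomial (Fin 2) ℂ)
      commute := by
        ext s
        exact smul_comm (MvPolynomial.X 0 : MvPolynomial (Fin 2) ℂ)
          (MvPolynomial.X 1 : MvPolynomial (Fin 2) ℂ) (s : Γ(E.obj.sheaf, ⊤))
      equivariant g a := by
        ext s
        refine (E.obj.linTop_smul g⁻¹ _ s).trans ?_
        simp [polyComp, add_smul, MvPolynomial.C_mul'] }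
  map {E F} f :=
    { lin :=
        { toFun := f.hom.hom.app ⊤
          map_add' := map_add (f.hom.hom.app ⊤).hom
          map_smul' := sections_app_smul f.hom.hom ⊤ }
      comm_ρ g := by
        ext s
        exact (DFunLike.congr_fun (congrArg topMap (f.hom.comm g⁻¹)) s)
      comm_X a := by
        ext s
        exact (f.hom.hom.app_smul _ s) }

instance : (globalSections G).Additive where
instance : (globalSections G).Linear ℂ where

instance : (globalSections G).Faithful where
  map_injective {E F} f f' h := by
    have := E.property.1
    refine ObjectProperty.hom_ext _ (EquivariantSheaf.hom_ext (hom_ext_of_isQuasicoherent fun s => ?_))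
    exact congr($(congrArg SkewModule.Hom.lin h) s)

instance : (globalSections G).Full where
  map_surjective {E F} L := by
    have := E.property.1
    let L' : Γ(E.obj.sheaf, ⊤) →ₗ[ℂ] Γ(F.obj.sheaf, ⊤) := L.lin
    obtain ⟨f, hf⟩ := exists_hom_of_isQuasicoherent (M := E.obj.sheaf) (N := F.obj.sheaf)
      { toFun := L.lin
        map_add' := map_add L.lin
        map_smul' := map_polynomial_smul L'
          fun i s => congr($(L.comm_X i) s) }
    refine ⟨ObjectProperty.homMk ⟨f, fun g => ?_⟩, SkewModule.hom_ext (LinearMap.ext hf)⟩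
    refine topMap_injective (φ := CommRingCat.ofHom (polyComp g.1).toRingHom)
      (AddMonoidHom.ext fun s => ?_)
    refine (hf _).trans (Eq.trans ?_ (congrArg (topMap (F.obj.lin g)) (hf s)).symm)
    have := congr($(L.comm_ρ g⁻¹) s)
    exact (congrArg (fun h => L.lin (E.obj.linTop h s)) (inv_inv g)).symm.trans
      (this.trans (congrArg (fun h => F.obj.linTop h (L.lin s)) (inv_inv g)))

end GlobalSectionsFunctor

section CommutingPair

variable {W : Type*} [AddCommGroup W] [Module ℂ W]

open scoped IsMulCommutative in
/-- Polynomials in two commuting operators. -/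
theorem exists_aeval_of_commute (X : Fin 2 → Module.End ℂ W) (h : X 0 * X 1 = X 1 * X 0) :
    ∃ φ : MvPolynomial (Fin 2) ℂ →ₐ[ℂ] Module.End ℂ W, ∀ i, φ (MvPolynomial.X i) = X i := by
  have hc : ∀ a ∈ Set.range X, ∀ b ∈ Set.range X, a * b = b * a := by
    rintro _ ⟨i, rfl⟩ _ ⟨j, rfl⟩
    fin_cases i <;> fin_cases j <;> simp [h]
  -- Evaluation of polynomials needs a commutative target, so it takes place in the subalgebra
  -- generated by the two operators.
  have := Algebra.isMulCommutative_adjoin ℂ hc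
  refine ⟨(Algebra.adjoin ℂ (Set.range X)).val.comp (MvPolynomial.aeval fun i =>
    (⟨X i, Algebra.subset_adjoin ⟨i, rfl⟩⟩ : Algebra.adjoin ℂ (Set.range X))), fun i => ?_⟩
  simp

end CommutingPair

namespace SkewModule

variable {G : Subgroup SL(2, ℂ)} (N : SkewModule.{0} G)

/-- The action of polynomials. -/
def polyAct : MvPolynomial (Fin 2) ℂ →ₐ[ℂ] Module.End ℂ N.W :=
  (exists_aeval_of_commute N.X N.commute).choose

theorem polyAct_X (i : Fin 2) : N.polyAct (MvPolynomial.X i) = N.X i :=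
  (exists_aeval_of_commute N.X N.commute).choose_spec i

theorem ρ_polyAct (g : G) (r : MvPolynomial (Fin 2) ℂ) (w : N.W) :
    N.ρ g (N.polyAct r w) = N.polyAct (polyComp (g⁻¹ : G).1 r) (N.ρ g w) := by
  induction r using MvPolynomial.induction_on generalizing w with
  | C c =>
    rw [← MvPolynomial.algebraMap_eq, AlgHom.commutes, AlgHom.commutes, AlgHom.commutes]
    exact map_smul _ _ _
  | add p q hp hq => simp [hp, hq]
  | mul_X p i hp =>
    have := congr($(N.equivariant g i) w)
    simp only [LinearMap.comp_apply] at this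
    rw [map_mul, map_mul, map_mul, Module.End.mul_apply, hp, polyAct_X, this]
    simp [polyComp, MvPolynomial.C_mul', polyAct_X]

/-- The underlying module over the polynomial ring. -/
def toModuleCat : ModuleCat.{0} (CommRingCat.of (MvPolynomial (Fin 2) ℂ)) :=
  letI : Module (MvPolynomial (Fin 2) ℂ) N.W := Module.compHom N.W N.polyAct.toRingHom
  ModuleCat.of (MvPolynomial (Fin 2) ℂ) N.W

instance : Module.Finite (CommRingCat.of (MvPolynomial (Fin 2) ℂ)) N.toModuleCat := by
  let _ : Module (MvPolynomial (Fin 2) ℂ) N.W := Module.compHom N.W N.polyAct.toRingHom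
  have : IsScalarTower ℂ (MvPolynomial (Fin 2) ℂ) N.W :=
    IsScalarTower.of_algebraMap_smul fun c w => by
      change N.polyAct (algebraMap ℂ _ c) w = _
      rw [AlgHom.commutes]
      rfl
  exact Module.Finite.of_restrictScalars_finite ℂ (MvPolynomial (Fin 2) ℂ) N.W

/-- The global sections of the associated sheaf. -/
def toTilde : N.W ≃+ Γ(tilde N.toModuleCat, ⊤) := (tildeTop N.toModuleCat).toAddEquiv

theorem toTilde_polyAct (r : MvPolynomial (Fin 2) ℂ) (w : N.W) :
    N.toTilde (N.polyAct r w) = r • N.toTilde w :=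
  (tildeTop N.toModuleCat).map_smul r w

/-- The global sections of the associated sheaf, as a complex vector space. -/
def toTildeₗ : N.W ≃ₗ[ℂ] Γ(tilde N.toModuleCat, ⊤) :=
  { N.toTilde with
    map_smul' := fun c w => by
      have := N.toTilde_polyAct (algebraMap ℂ _ c) w
      rw [AlgHom.commutes] at this
      exact this }

theorem exists_lin (g : G) : ∃ a : tilde N.toModuleCat ⟶
    (pushforward (planeMap g.1)).obj (tilde N.toModuleCat),
      topMap a = (N.toTilde.toAddMonoidHom.comp (N.ρ g⁻¹).toAddMonoidHom).comp
        N.toTilde.symm.toAddMonoidHom := by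
  refine exists_topMap_eq (φ := CommRingCat.ofHom (polyComp g.1).toRingHom) _ fun r s => ?_
  obtain ⟨w, rfl⟩ := N.toTilde.surjective s
  have h := N.ρ_polyAct g⁻¹ r w
  rw [inv_inv] at h
  change N.toTilde (N.ρ g⁻¹ (N.toTilde.symm ((show MvPolynomial (Fin 2) ℂ from r) • N.toTilde w))) =
    polyComp g.1 r • N.toTilde (N.ρ g⁻¹ (N.toTilde.symm (N.toTilde w)))
  rw [← toTilde_polyAct, ← toTilde_polyAct, AddEquiv.symm_apply_apply, AddEquiv.symm_apply_apply, h]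

/-- The equivariant sheaf associated with a module over the skew group algebra. -/
def toSheaf : EquivariantSheaf G where
  sheaf := tilde N.toModuleCat
  lin g := (N.exists_lin g).choose
  lin_one := by
    -- The linearization is chosen by its effect on global sections, and its two axioms can be
    -- checked there, where they reduce to those of the representation `ρ`.
    refine topMap_injective (φ := CommRingCat.ofHom (polyComp (1 : G).1).toRingHom)
      (AddMonoidHom.ext fun s => ?_)
    refine (DFunLike.congr_fun (N.exists_lin 1).choose_spec s).trans
      (Eq.trans ?_ (topMap_id planeMap_one.symm s).symm)
    simp
  lin_mul g h := by
    refine topMap_injective (φ := CommRingCat.ofHom (polyComp (g * h : G).1).toRingHom)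
      (AddMonoidHom.ext fun s => ?_)
    refine (DFunLike.congr_fun (N.exists_lin (g * h)).choose_spec s).trans
      (Eq.trans ?_ (topMap_comp (planeMap_mul g.1 h.1).symm _ _ s).symm)
    rw [(N.exists_lin g).choose_spec, (N.exists_lin h).choose_spec]
    simp

theorem linTop_toSheaf (g : G) (w : N.W) :
    N.toSheaf.linTop g (N.toTilde w) = N.toTilde (N.ρ g⁻¹ w) :=
  (DFunLike.congr_fun (N.exists_lin g).choose_spec _).trans (by simp)

theorem isFiniteCoherent_toSheaf : isFiniteCoherent G N.toSheaf :=
  ⟨inferInstanceAs (tilde N.toModuleCat).IsQuasicoherent, isFiniteType_tilde N.toModuleCat,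
    Module.Finite.equiv N.toTildeₗ⟩

end SkewModule

section GlobalSectionsEquivalence

variable (G : Subgroup SL(2, ℂ))

instance : (globalSections G).EssSurj where
  mem_essImage N := by
    refine ⟨⟨N.toSheaf, N.isFiniteCoherent_toSheaf⟩,
      ⟨(SkewModule.isoMk N.toTildeₗ (fun g w => ?_) fun a w => ?_).symm⟩⟩
    · exact (congrArg (fun h => N.toTilde (N.ρ h w)) (inv_inv g)).symm.trans
        (N.linTop_toSheaf g⁻¹ w).symm
    · exact (congrArg (fun f : Module.End ℂ N.W => N.toTilde (f w)) (N.polyAct_X a)).symm.trans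
        (N.toTilde_polyAct _ w)

instance : (globalSections G).IsEquivalence where

end GlobalSectionsEquivalence

/-! ### Equivariant pairs as intertwiners into the tensor product with `ℂ²`. -/

section Intertwiners

variable {G : Subgroup SL(2, ℂ)}

theorem sum_smul_sum_smul {n E : Type*} [Fintype n] [DecidableEq n] [AddCommGroup E] [Module ℂ E]
    {A B : Matrix n n ℂ} (h : A * B = 1) (v : n → E) (a : n) :
    ∑ b, A a b • ∑ c, B b c • v c = v a := by
  simp_rw [Finset.smul_sum, smul_smul]
  rw [Finset.sum_comm]
  simp_rw [← Finset.sum_smul, ← Matrix.mul_apply, h, Matrix.one_apply, ite_smul]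
  simp

theorem coe_mul_coe_inv (g : G) : g.1.1 * (g⁻¹ : G).1.1 = 1 := by
  rw [InvMemClass.coe_inv, ← Matrix.SpecialLinearGroup.coe_mul, mul_inv_cancel,
    Matrix.SpecialLinearGroup.coe_one]

theorem coe_inv_mul_coe (g : G) : (g⁻¹ : G).1.1 * g.1.1 = 1 := by
  rw [InvMemClass.coe_inv, ← Matrix.SpecialLinearGroup.coe_mul, inv_mul_cancel,
    Matrix.SpecialLinearGroup.coe_one]

section

variable {P Q : Type*} [AddCommGroup P] [Module ℂ P] [AddCommGroup Q] [Module ℂ Q]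

/-- Multiplying by the matrix of `g` inverts the defining condition. In this form the pair is
visibly an intertwiner into `Q ⊗ ℂ²`. -/
theorem mem_equivariantPairs_iff {ρ : Representation ℂ G P} {σ : Representation ℂ G Q}
    {f : Fin 2 → P →ₗ[ℂ] Q} : f ∈ equivariantPairs ρ σ ↔
      ∀ g a, f a ∘ₗ ρ g = ∑ b, g.1.1 a b • (σ g ∘ₗ f b) := by
  refine ⟨fun h g a => ?_, fun h g a => ?_⟩
  · simp_rw [mem_equivariantPairs.1 h g]
    exact (sum_smul_sum_smul (coe_mul_coe_inv g) (fun b => f b ∘ₗ ρ g) a).symm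
  · simp_rw [h g]
    exact (sum_smul_sum_smul (coe_inv_mul_coe g) (fun b => σ g ∘ₗ f b) a).symm

/-- The linear maps that commute with the action of `G`. -/
def intertwiners (ρ : Representation ℂ G P) (σ : Representation ℂ G Q) :
    Submodule ℂ (P →ₗ[ℂ] Q) where
  carrier := {f | ∀ g, f ∘ₗ ρ g = σ g ∘ₗ f}
  add_mem' {f f'} hf hf' g := by rw [LinearMap.add_comp, LinearMap.comp_add, hf g, hf' g]
  zero_mem' g := by simp
  smul_mem' c f hf g := by rw [LinearMap.smul_comp, LinearMap.comp_smul, hf g]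

end

/-- Morphisms of finite-dimensional representations as intertwining linear maps. -/
def intertwinersEquivHom (V W : FDRep ℂ G) : intertwiners V.ρ W.ρ ≃ₗ[ℂ] (V ⟶ W) where
  toFun f := ⟨InducedCategory.homMk (ModuleCat.ofHom f.1), fun g => by
    ext v
    exact congr($(f.2 g) v)⟩
  map_add' _ _ := rfl
  map_smul' _ _ := rfl
  invFun f := ⟨f.hom.hom.hom, fun g => congr($(f.comm g).hom.hom)⟩

theorem piScalarRight_map {Q : Type*} [AddCommGroup Q] [Module ℂ Q] (s : Q →ₗ[ℂ] Q)
    (m : Matrix (Fin 2) (Fin 2) ℂ) (z : Q ⊗[ℂ] (Fin 2 → ℂ)) (a : Fin 2) :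
    TensorProduct.piScalarRight ℂ ℂ Q (Fin 2) (TensorProduct.map s (Matrix.toLin' m) z) a =
      ∑ b, m a b • s (TensorProduct.piScalarRight ℂ ℂ Q (Fin 2) z b) := by
  induction z with
  | zero => simp
  | add x y hx hy => simp only [map_add, Pi.add_apply, hx, hy, smul_add, Finset.sum_add_distrib]
  | tmul q v =>
    simp only [TensorProduct.map_tmul, Matrix.toLin'_apply, TensorProduct.piScalarRight_apply,
      TensorProduct.piScalarRightHom_tmul, Matrix.mulVec, dotProduct, map_smul, smul_smul,
      Finset.sum_smul]

/-- The natural representation, unbundled. -/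
def planeRep (G : Subgroup SL(2, ℂ)) : Representation ℂ G (Fin 2 → ℂ) where
  toFun g := Matrix.toLin' g.1.1
  map_one' := Matrix.toLin'_one
  map_mul' g h := Matrix.toLin'_mul g.1.1 h.1.1

theorem piScalarRight_tprod {Q : Type*} [AddCommGroup Q] [Module ℂ Q] (σ : Representation ℂ G Q)
    (g : G) (z : Q ⊗[ℂ] (Fin 2 → ℂ)) (a : Fin 2) :
    TensorProduct.piScalarRight ℂ ℂ Q (Fin 2) (σ.tprod (planeRep G) g z) a =
      ∑ b, g.1.1 a b • σ g (TensorProduct.piScalarRight ℂ ℂ Q (Fin 2) z b) :=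
  piScalarRight_map (σ g) g.1.1 z a

/-- Equivariant pairs as intertwining maps to the tensor product with the natural
representation. -/
def equivariantPairsEquivIntertwiners {P Q : Type*} [AddCommGroup P] [Module ℂ P] [AddCommGroup Q]
    [Module ℂ Q] (ρ : Representation ℂ G P) (σ : Representation ℂ G Q) :
    equivariantPairs ρ σ ≃ₗ[ℂ] intertwiners ρ (σ.tprod (planeRep G)) where
  toFun f := ⟨(TensorProduct.piScalarRight ℂ ℂ Q (Fin 2)).symm.toLinearMap ∘ₗ
    LinearMap.pi f.1, fun g => by
      refine LinearMap.ext fun v => (TensorProduct.piScalarRight ℂ ℂ Q (Fin 2)).injective ?_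
      refine Eq.trans (LinearEquiv.apply_symm_apply _ _) (funext fun a => ?_)
      rw [LinearMap.comp_apply, piScalarRight_tprod]
      refine Eq.trans congr($(mem_equivariantPairs_iff.1 f.2 g a) v) ?_
      simp only [LinearMap.comp_apply, LinearEquiv.coe_coe, LinearEquiv.apply_symm_apply,
        LinearMap.sum_apply, LinearMap.smul_apply, LinearMap.pi_apply]⟩
  map_add' f f' := Subtype.ext (LinearMap.ext fun v => map_add
    (TensorProduct.piScalarRight ℂ ℂ Q (Fin 2)).symm _ _)
  map_smul' c f := Subtype.ext (LinearMap.ext fun v => map_smul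
    (TensorProduct.piScalarRight ℂ ℂ Q (Fin 2)).symm _ _)
  invFun h := ⟨fun a => LinearMap.proj a ∘ₗ
    (TensorProduct.piScalarRight ℂ ℂ Q (Fin 2)).toLinearMap ∘ₗ h.1,
    mem_equivariantPairs_iff.2 fun g a => by
      ext v
      refine Eq.trans (congr(TensorProduct.piScalarRight ℂ ℂ Q (Fin 2) ($(h.2 g) v) a)) ?_
      rw [LinearMap.comp_apply, piScalarRight_tprod]
      simp only [LinearMap.comp_apply, LinearEquiv.coe_coe, LinearMap.sum_apply,
        LinearMap.smul_apply, LinearMap.proj_apply]⟩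
  left_inv f := by
    refine Subtype.ext (funext fun a => LinearMap.ext fun v => ?_)
    simp only [LinearMap.comp_apply, LinearEquiv.coe_coe, LinearMap.proj_apply,
      LinearEquiv.apply_symm_apply, LinearMap.pi_apply]
  right_inv h := by
    refine Subtype.ext (LinearMap.ext fun v =>
      (TensorProduct.piScalarRight ℂ ℂ Q (Fin 2)).injective (funext fun a => ?_))
    simp only [LinearMap.comp_apply, LinearEquiv.coe_coe, LinearMap.proj_apply,
      LinearEquiv.apply_symm_apply, LinearMap.pi_apply]

theorem finrank_equivariantPairs (V W : FDRep ℂ G) :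
    Module.finrank ℂ (equivariantPairs V.ρ W.ρ) =
      Module.finrank ℂ (V ⟶ W ⊗ naturalRep G) := by
  refine (equivariantPairsEquivIntertwiners V.ρ W.ρ).finrank_eq.trans ?_
  exact (intertwinersEquivHom V (FDRep.of (Representation.tprod W.ρ (planeRep G)))).finrank_eq

end Intertwiners

/-! ### Schur's lemma and complete reducibility. -/

section IrreducibleRepresentations

variable {G : Subgroup SL(2, ℂ)}

theorem FDRep.nontrivial_of_simple (V : FDRep ℂ G) [Simple V] : Nontrivial V := by
  by_contra h
  rw [not_nontrivial_iff_subsingleton] at h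
  refine id_nonzero V ((intertwinersEquivHom V V).symm.injective (Subtype.ext ?_))
  exact LinearMap.ext fun v => Subsingleton.elim _ _

theorem finrank_intertwiners (V W : FDRep ℂ G) :
    Module.finrank ℂ (intertwiners V.ρ W.ρ) = Module.finrank ℂ (V ⟶ W) :=
  (intertwinersEquivHom V W).finrank_eq

theorem exists_eq_smul_id_of_mem_intertwiners (V : FDRep ℂ G) [Simple V] {f : V →ₗ[ℂ] V}
    (hf : f ∈ intertwiners V.ρ V.ρ) : ∃ c : ℂ, f = c • LinearMap.id := by
  have := V.nontrivial_of_simple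
  have h1 : Module.finrank ℂ (intertwiners V.ρ V.ρ) = 1 := by
    rw [finrank_intertwiners, FDRep.finrank_hom_simple_simple, if_pos ⟨Iso.refl V⟩]
  have hid : (LinearMap.id : V →ₗ[ℂ] V) ∈ intertwiners V.ρ V.ρ := fun _ => rfl
  obtain ⟨c, hc⟩ := (finrank_eq_one_iff_of_nonzero' (⟨LinearMap.id, hid⟩ : intertwiners V.ρ V.ρ)
    (fun h => one_ne_zero (α := Module.End ℂ V) congr($h.1))).1 h1 ⟨f, hf⟩
  exact ⟨c, congr($hc.1).symm⟩

theorem eq_zero_of_mem_intertwiners (V W : FDRep ℂ G) [Simple V] [Simple W]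
    (h : ¬ Nonempty (V ≅ W)) {f : V →ₗ[ℂ] W} (hf : f ∈ intertwiners V.ρ W.ρ) : f = 0 := by
  have h0 : (intertwinersEquivHom V W ⟨f, hf⟩) = 0 := by
    by_contra h0
    have := isIso_of_hom_simple h0
    exact h ⟨asIso (intertwinersEquivHom V W ⟨f, hf⟩)⟩
  rw [LinearEquiv.map_eq_zero_iff] at h0
  exact congr($h0.1)

open scoped MonoidAlgebra

theorem exists_addEquiv_of_isSimpleModule [Finite G] {I : Type*} (π : I → FDRep ℂ G)
    (hπ : ∀ ρ : FDRep ℂ G, Simple ρ → ∃ i, Nonempty (ρ ≅ π i)) (S : Type) [AddCommGroup S]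
    [Module ℂ[G] S] [IsSimpleModule ℂ[G] S] :
    ∃ (i : I) (f : S ≃+ π i), (∀ (c : ℂ) s, f (algebraMap ℂ ℂ[G] c • s) = c • f s) ∧
      ∀ g s, f (MonoidAlgebra.of ℂ G g • s) = (π i).ρ g (f s) := by
  let _ : Module ℂ S := Module.compHom S (algebraMap ℂ ℂ[G])
  have : IsScalarTower ℂ ℂ[G] S := IsScalarTower.of_algebraMap_smul fun _ _ => rfl
  have : FiniteDimensional ℂ S := Module.Finite.trans ℂ[G] S
  have : Nontrivial S := IsSimpleModule.nontrivial ℂ[G] S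
  let ρ : Representation ℂ G S :=
    { toFun g := Algebra.lsmul ℂ ℂ S (MonoidAlgebra.of ℂ G g)
      map_one' := by rw [map_one, map_one]
      map_mul' g h := by rw [map_mul, map_mul] }
  have hS : Simple (FDRep.of ρ) := by
    rw [FDRep.simple_iff_end_is_rank_one, ← (intertwinersEquivHom _ _).finrank_eq]
    change Module.finrank ℂ (intertwiners ρ ρ) = 1
    have hid : (LinearMap.id : S →ₗ[ℂ] S) ∈ intertwiners ρ ρ := fun _ => rfl
    refine (finrank_eq_one_iff_of_nonzero' (⟨LinearMap.id, hid⟩ : intertwiners ρ ρ)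
      (fun h => one_ne_zero (α := Module.End ℂ S) congr($h.1))).2 fun f => ?_
    -- Schur's lemma over an algebraically closed field: a rank-one endomorphism space then gives
    -- simplicity as a representation.
    obtain ⟨c, hc⟩ := (IsSimpleModule.algebraMap_end_bijective_of_isAlgClosed (A := ℂ[G]) (V := S)
      ℂ).2 (MonoidAlgebra.equivariantOfLinearOfComm f.1 fun g v => congr($(f.2 g) v))
    exact ⟨c, Subtype.ext (LinearMap.ext fun v => congr($hc v))⟩
  obtain ⟨i, ⟨e⟩⟩ := hπ (FDRep.of ρ) hS
  refine ⟨i, (FDRep.isoToLinearEquiv e).toAddEquiv, (FDRep.isoToLinearEquiv e).map_smul,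
    fun g s => ?_⟩
  exact congr($(((intertwinersEquivHom _ _).symm e.hom).2 g) s)

theorem exists_equiv_pi [Finite G] {I : Type*} (π : I → FDRep ℂ G)
    (hπ : ∀ ρ : FDRep ℂ G, Simple ρ → ∃ i, Nonempty (ρ ≅ π i)) {W : Type} [AddCommGroup W]
    [Module ℂ W] [FiniteDimensional ℂ W] (σ : Representation ℂ G W) :
    ∃ (n : ℕ) (i : Fin n → I) (e : W ≃ₗ[ℂ] Π k, π (i k)),
      ∀ g w k, e (σ g w) k = (π (i k)).ρ g (e w k) := by
  have : Module.Finite ℂ[G] σ.asModule := Module.Finite.of_restrictScalars_finite ℂ _ _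
  obtain ⟨n, S, e, hS⟩ := IsSemisimpleModule.exists_linearEquiv_fin_dfinsupp ℂ[G] σ.asModule
  choose i f hf hg using fun k => exists_addEquiv_of_isSimpleModule π hπ (S k)
  refine ⟨n, i,
    { toAddEquiv := (σ.asModuleEquiv.symm.toAddEquiv.trans e.toAddEquiv).trans
        ((DFinsupp.linearEquivFunOnFintype (R := ℂ[G])).toAddEquiv.trans (AddEquiv.piCongrRight f))
      map_smul' c w := funext fun k => ?_ }, fun g w k => ?_⟩
  · change f k ((e (σ.asModuleEquiv.symm (c • w))) k) = c • f k ((e (σ.asModuleEquiv.symm w)) k)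
    rw [Representation.asModuleEquiv_symm_map_smul, map_smul, DFinsupp.smul_apply, hf]
  · change f k ((e (σ.asModuleEquiv.symm (σ g w))) k) =
      (π (i k)).ρ g (f k ((e (σ.asModuleEquiv.symm w)) k))
    rw [Representation.asModuleEquiv_symm_map_rho, map_smul, DFinsupp.smul_apply, hg]

end IrreducibleRepresentations

/-! ### Contraction of pairs with the symplectic form. -/

section Bracket

variable {G : Subgroup SL(2, ℂ)} {P Q R : Type*} [AddCommGroup P] [Module ℂ P] [AddCommGroup Q]
  [Module ℂ Q] [AddCommGroup R] [Module ℂ R]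

/-- The composite of two pairs of linear maps, contracted with the symplectic form of `ℂ²`. -/
def bracket (f : Fin 2 → Q →ₗ[ℂ] R) (h : Fin 2 → P →ₗ[ℂ] Q) : P →ₗ[ℂ] R :=
  f 0 ∘ₗ h 1 - f 1 ∘ₗ h 0

theorem bracket_smul_smul (c d : ℂ) (f : Fin 2 → Q →ₗ[ℂ] R) (h : Fin 2 → P →ₗ[ℂ] Q) :
    bracket (c • f) (d • h) = (c * d) • bracket f h := by
  simp [bracket, LinearMap.comp_smul, LinearMap.smul_comp, smul_smul, smul_sub, mul_comm]

theorem bracket_sum {ι : Type*} (s : Finset ι) (f : Fin 2 → Q →ₗ[ℂ] R)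
    (h : ι → Fin 2 → P →ₗ[ℂ] Q) : bracket f (∑ k ∈ s, h k) = ∑ k ∈ s, bracket f (h k) := by
  ext v
  simp [bracket]

/-- Cyclicity of the trace against the antisymmetry of the form. This sign is the source of the
condition `ε i j = -ε j i`. -/
theorem trace_bracket_swap [FiniteDimensional ℂ P] [FiniteDimensional ℂ Q]
    (f : Fin 2 → Q →ₗ[ℂ] P) (h : Fin 2 → P →ₗ[ℂ] Q) :
    LinearMap.trace ℂ P (bracket f h) = - LinearMap.trace ℂ Q (bracket h f) := by
  rw [bracket, bracket, map_sub, map_sub, LinearMap.trace_comp_comm' (f 0),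
    LinearMap.trace_comp_comm' (f 1), neg_sub]

/-- The action of `G` on pairs of linear maps. -/
def twist (ρ : Representation ℂ G P) (σ : Representation ℂ G Q) (g : G) (f : Fin 2 → P →ₗ[ℂ] Q) :
    Fin 2 → P →ₗ[ℂ] Q := fun a => ∑ b, g.1.1 a b • (σ g ∘ₗ f b ∘ₗ ρ g⁻¹)

variable {ρ : Representation ℂ G P} {σ : Representation ℂ G Q} {τ : Representation ℂ G R}

theorem rep_apply_inv_comp (ρ : Representation ℂ G P) (g : G) : ρ g ∘ₗ ρ g⁻¹ = LinearMap.id := by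
  rw [← Module.End.mul_eq_comp, ← map_mul, mul_inv_cancel, map_one]
  rfl

theorem rep_inv_comp_apply (ρ : Representation ℂ G P) (g : G) : ρ g⁻¹ ∘ₗ ρ g = LinearMap.id := by
  rw [← Module.End.mul_eq_comp, ← map_mul, inv_mul_cancel, map_one]
  rfl

theorem mem_equivariantPairs_iff_twist {f : Fin 2 → P →ₗ[ℂ] Q} :
    f ∈ equivariantPairs ρ σ ↔ ∀ g, twist ρ σ g f = f := by
  rw [mem_equivariantPairs_iff]
  refine forall_congr' fun g => ?_
  rw [funext_iff]
  refine forall_congr' fun a => ?_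
  have h : twist ρ σ g f a = (∑ b, g.1.1 a b • (σ g ∘ₗ f b)) ∘ₗ ρ g⁻¹ := by
    simp [twist, LinearMap.add_comp, LinearMap.smul_comp, LinearMap.comp_assoc]
  rw [h]
  refine ⟨fun h => ?_, fun h => ?_⟩
  · rw [← h, LinearMap.comp_assoc, rep_apply_inv_comp, LinearMap.comp_id]
  · conv_lhs => rw [← h]
    rw [LinearMap.comp_assoc, rep_inv_comp_apply, LinearMap.comp_id]

theorem twist_mul (g k : G) (f : Fin 2 → P →ₗ[ℂ] Q) :
    twist ρ σ (g * k) f = twist ρ σ g (twist ρ σ k f) := by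
  funext a
  ext v
  simp [twist, Matrix.mul_apply, Fin.sum_univ_two]
  module

theorem twist_sum {ι : Type*} (s : Finset ι) (g : G) (f : ι → Fin 2 → P →ₗ[ℂ] Q) :
    twist ρ σ g (∑ k ∈ s, f k) = ∑ k ∈ s, twist ρ σ g (f k) := by
  funext a
  ext v
  simp [twist, Finset.smul_sum, Finset.sum_add_distrib]

/-- Invariance of the symplectic form: the matrix of `g` contributes only its determinant, which is
`1`. -/
theorem bracket_twist_twist (g : G) (f : Fin 2 → Q →ₗ[ℂ] R) (h : Fin 2 → P →ₗ[ℂ] Q) :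
    bracket (twist σ τ g f) (twist ρ σ g h) = τ g ∘ₗ bracket f h ∘ₗ ρ g⁻¹ := by
  have hdet : g.1.1 0 0 * g.1.1 1 1 - g.1.1 0 1 * g.1.1 1 0 = 1 := by
    rw [← Matrix.det_fin_two]
    exact g.1.2
  have hσ (w : Q) : σ g⁻¹ (σ g w) = w := congr($(rep_inv_comp_apply σ g) w)
  ext v
  simp only [bracket, twist, Fin.sum_univ_two, LinearMap.sub_apply, LinearMap.comp_apply,
    LinearMap.add_apply, LinearMap.smul_apply, map_add, map_smul, map_sub, hσ]
  generalize τ g (f 0 (h 0 _)) = a, τ g (f 0 (h 1 _)) = b, τ g (f 1 (h 0 _)) = c,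
    τ g (f 1 (h 1 _)) = d
  trans (g.1.1 0 0 * g.1.1 1 1 - g.1.1 0 1 * g.1.1 1 0) • (b - c)
  · module
  · rw [hdet, one_smul]

theorem bracket_mem_intertwiners {f : Fin 2 → Q →ₗ[ℂ] R} {h : Fin 2 → P →ₗ[ℂ] Q}
    (hf : f ∈ equivariantPairs σ τ) (hh : h ∈ equivariantPairs ρ σ) :
    bracket f h ∈ intertwiners ρ τ := fun g => by
  have := bracket_twist_twist (ρ := ρ) (σ := σ) (τ := τ) g f h
  rw [mem_equivariantPairs_iff_twist.1 hf, mem_equivariantPairs_iff_twist.1 hh] at this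
  conv_lhs => rw [this]
  rw [LinearMap.comp_assoc, LinearMap.comp_assoc, rep_inv_comp_apply, LinearMap.comp_id]

theorem exists_trace_comp_ne_zero [FiniteDimensional ℂ P] [FiniteDimensional ℂ Q] {f : Q →ₗ[ℂ] P}
    (hf : f ≠ 0) : ∃ u : P →ₗ[ℂ] Q, LinearMap.trace ℂ P (f ∘ₗ u) ≠ 0 := by
  obtain ⟨q, hq⟩ : ∃ q, f q ≠ 0 := by
    by_contra! h
    exact hf (LinearMap.ext h)
  obtain ⟨l, hl⟩ := Module.Projective.exists_dual_ne_zero ℂ hq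
  refine ⟨l.smulRight q, ?_⟩
  rwa [show f ∘ₗ l.smulRight q = l.smulRight (f q) by ext v; simp, LinearMap.trace_smulRight]

/-- The trace of the contraction is a nondegenerate pairing on all pairs. It is `G`-invariant, so
summing a partner of an equivariant pair over `G` multiplies the pairing by the order of `G` and
makes the partner equivariant. -/
theorem exists_trace_bracket_ne_zero [Finite G] [FiniteDimensional ℂ P] [FiniteDimensional ℂ Q]
    {f : Fin 2 → Q →ₗ[ℂ] P} (hf : f ∈ equivariantPairs σ ρ) (h0 : f ≠ 0) :
    ∃ h ∈ equivariantPairs ρ σ, LinearMap.trace ℂ P (bracket f h) ≠ 0 := by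
  have := Fintype.ofFinite G
  obtain ⟨k, hk⟩ : ∃ k, LinearMap.trace ℂ P (bracket f k) ≠ 0 := by
    obtain ⟨a, ha⟩ := Function.ne_iff.1 h0
    obtain ⟨u, hu⟩ := exists_trace_comp_ne_zero ha
    -- The contraction couples the component `a` of `f` with the other component of its partner, so
    -- just the term in `f a` survives, up to sign.
    refine ⟨fun b => if b = a then 0 else u, ?_⟩
    fin_cases a <;> simpa [bracket] using hu
  refine ⟨∑ g, twist ρ σ g k, mem_equivariantPairs_iff_twist.2 fun g => ?_, ?_⟩
  · rw [twist_sum]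
    simp_rw [← twist_mul]
    exact Equiv.sum_comp (Equiv.mulLeft g) fun g => twist ρ σ g k
  · have h (g : G) : LinearMap.trace ℂ P (bracket f (twist ρ σ g k)) =
        LinearMap.trace ℂ P (bracket f k) := by
      conv_lhs => rw [← mem_equivariantPairs_iff_twist.1 hf g, bracket_twist_twist]
      rw [LinearMap.trace_comp_comm', LinearMap.comp_assoc, rep_inv_comp_apply, LinearMap.comp_id]
    rw [bracket_sum, map_sum]
    simpa [h] using hk

end Bracket

/-! ### Normalized generators along the edges. -/

section SpanningPairs

variable {G : Subgroup SL(2, ℂ)} {I : Type*}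

/-- Generators `φ i j` of the spaces of equivariant pairs of maps between the representations at
the vertices of a graph, with contractions given by the signs `ε` up to factors at the vertices. -/
structure SpanningPairs (Γ : SimpleGraph I) (ε : I → I → ℤˣ) (π : I → FDRep ℂ G) where
  φ : ∀ i j, Fin 2 → π j →ₗ[ℂ] π i
  mem : ∀ i j, φ i j ∈ equivariantPairs (π j).ρ (π i).ρ
  span : ∀ i j, ∀ f ∈ equivariantPairs (π j).ρ (π i).ρ, ∃ c : ℂ, f = c • φ i j
  ne_zero : ∀ i j, Γ.Adj i j → φ i j ≠ 0
  eq_zero : ∀ i j, ¬ Γ.Adj i j → φ i j = 0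
  κ : I → ℂ
  κ_ne_zero : ∀ i, κ i ≠ 0
  bracket_self : ∀ i j, Γ.Adj i j → bracket (φ i j) (φ j i) = κ i • ε i j • LinearMap.id
  bracket_of_ne : ∀ i j k, i ≠ k → bracket (φ i j) (φ j k) = 0

/-- The generators are unique up to scalars, and the sole invariant of an edge is the trace `b i j =
-b j i ≠ 0`. Since `u i * ε i j` has the same antisymmetry, one rescaling per edge matches the two.
-/
theorem exists_spanningPairs [Finite G] {Γ : SimpleGraph I} [DecidableRel Γ.Adj]
    {π : I → FDRep ℂ G} (hΓ : IsMcKayGraph G Γ π) (ε : I → I → ℤˣ) (u : I → ℤˣ)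
    (hε : ∀ i j, Γ.Adj i j → u i * ε i j = -(u j * ε j i)) :
    Nonempty (SpanningPairs Γ ε π) := by
  classical
  have hsimple := hΓ.simple
  have hrank (i j : I) : Module.finrank ℂ (equivariantPairs (π j).ρ (π i).ρ) =
      if Γ.Adj j i then 1 else 0 := by
    rw [finrank_equivariantPairs, hΓ.multiplicity]
  have hfin (i j : I) : FiniteDimensional ℂ (Fin 2 → π j →ₗ[ℂ] π i) := inferInstance
  have h1 (i j : I) : ∃ f ∈ equivariantPairs (π j).ρ (π i).ρ,
      (Γ.Adj i j → f ≠ 0) ∧ (¬ Γ.Adj i j → f = 0) ∧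
      ∀ f' ∈ equivariantPairs (π j).ρ (π i).ρ, ∃ c : ℂ, f' = c • f := by
    by_cases h : Γ.Adj i j
    · have hr := hrank i j
      rw [if_pos h.symm, finrank_eq_one_iff'] at hr
      obtain ⟨f, hf, hs⟩ := hr
      refine ⟨f.1, f.2, fun _ h0 => hf (Subtype.ext h0), fun h' => absurd h h', fun f' hf' => ?_⟩
      obtain ⟨c, hc⟩ := hs ⟨f', hf'⟩
      exact ⟨c, congr($hc.1).symm⟩
    · have hr := hrank i j
      rw [if_neg fun h' => h h'.symm, Submodule.finrank_eq_zero] at hr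
      refine ⟨0, zero_mem _, fun h' => absurd h' h, fun _ => rfl, fun f' hf' => ⟨0, ?_⟩⟩
      rw [hr, Submodule.mem_bot] at hf'
      simp [hf']
  choose f hf hf0 hf1 hspan using h1
  set b : I → I → ℂ := fun i j => LinearMap.trace ℂ (π i) (bracket (f i j) (f j i)) with hb
  have hb0 (i j : I) (h : Γ.Adj i j) : b i j ≠ 0 := by
    obtain ⟨k, hk, hne⟩ := exists_trace_bracket_ne_zero (hf i j) (hf0 i j h)
    obtain ⟨c, rfl⟩ := hspan j i k hk
    intro h0
    refine hne ?_
    have := bracket_smul_smul 1 c (f i j) (f j i)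
    rw [one_smul, one_mul] at this
    rw [this, map_smul]
    simp only [hb] at h0
    rw [h0, smul_zero]
  have hbs (i j : I) : b i j = - b j i := trace_bracket_swap _ _
  -- The signs `u i * ε i j` orient each edge: exactly one of its two generators is rescaled.
  let s : I → I → ℂ := fun i j => if Γ.Adj i j ∧ u i * ε i j = 1 then (b i j)⁻¹ else 1
  have hs (i j : I) : s i j ≠ 0 := by
    simp only [s]
    split_ifs with h
    · exact inv_ne_zero (hb0 i j h.1)
    · exact one_ne_zero
  have hss (i j : I) (h : Γ.Adj i j) : s i j * s j i * b i j = ((u i * ε i j : ℤˣ) : ℤ) := by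
    have h2 := hε j i h.symm
    simp only [s, h, h.symm, true_and]
    rcases Int.units_eq_one_or (u i * ε i j) with h1 | h1
    · rw [h1] at h2
      simp [h1, h2, hb0 i j h]
    · rw [h1, neg_neg] at h2
      simp [h1, h2, hbs i j, hb0 j i h.symm]
  have hdim (i : I) : (Module.finrank ℂ (π i) : ℂ) ≠ 0 := by
    have := (π i).nontrivial_of_simple
    exact_mod_cast Module.finrank_pos.ne'
  have hbr (i j k : I) : bracket (s i j • f i j) (s j k • f j k) ∈
      intertwiners (π k).ρ (π i).ρ :=
    bracket_mem_intertwiners (Submodule.smul_mem _ _ (hf i j)) (Submodule.smul_mem _ _ (hf j k))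
  refine ⟨
    { φ i j := s i j • f i j
      mem i j := Submodule.smul_mem _ _ (hf i j)
      span i j f' hf' := ?_
      ne_zero i j h := smul_ne_zero (hs i j) (hf0 i j h)
      eq_zero i j h := by rw [hf1 i j h, smul_zero]
      -- A scalar operator on `π i` with trace `u i * ε i j` is this factor times `ε i j`.
      κ i := (u i : ℤ) * (Module.finrank ℂ (π i) : ℂ)⁻¹
      κ_ne_zero i := ?_
      bracket_self i j h := ?_
      bracket_of_ne i j k h := ?_ }⟩
  · obtain ⟨c, rfl⟩ := hspan i j f' hf'
    exact ⟨c * (s i j)⁻¹, by rw [smul_smul, inv_mul_cancel_right₀ (hs i j)]⟩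
  · refine mul_ne_zero ?_ (inv_ne_zero (hdim i))
    exact_mod_cast (u i).ne_zero
  · obtain ⟨c, hc⟩ := exists_eq_smul_id_of_mem_intertwiners (π i) (hbr i j i)
    have ht : c * Module.finrank ℂ (π i) = ((u i * ε i j : ℤˣ) : ℤ) := by
      rw [← hss i j h]
      have := congrArg (LinearMap.trace ℂ (π i)) hc
      rw [bracket_smul_smul, map_smul, map_smul, LinearMap.trace_id] at this
      exact this.symm
    rw [hc, ← mul_inv_cancel_right₀ (hdim i) c, ht, Units.smul_def, ← Int.cast_smul_eq_zsmul ℂ,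
      smul_smul]
    push_cast
    ring_nf
  · exact eq_zero_of_mem_intertwiners (π k) (π i)
      (fun h' => h (hΓ.injective k i h').symm) (hbr i j k)

end SpanningPairs

/-! ### Block matrices and linear maps between tensor products. -/

section BlockMaps

variable {I : Type*} [DecidableEq I] {A B C : I → Type*} [∀ i, AddCommGroup (A i)]
  [∀ i, Module ℂ (A i)] [∀ i, AddCommGroup (B i)] [∀ i, Module ℂ (B i)]
  [∀ i, AddCommGroup (C i)] [∀ i, Module ℂ (C i)]

/-- A component of a linear map between products. -/
def blockEntry (f : (Π i, A i) →ₗ[ℂ] Π i, B i) (i j : I) : A j →ₗ[ℂ] B i :=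
  LinearMap.proj i ∘ₗ f ∘ₗ LinearMap.single ℂ A j

/-- The linear map between products with given components. -/
def blockMap [Fintype I] (m : ∀ i j, A j →ₗ[ℂ] B i) : (Π i, A i) →ₗ[ℂ] Π i, B i :=
  LinearMap.pi fun i => ∑ j, m i j ∘ₗ LinearMap.proj j

/-- The diagonal linear map between products with given components. -/
def diagMap (d : ∀ i, A i →ₗ[ℂ] B i) : (Π i, A i) →ₗ[ℂ] Π i, B i :=
  LinearMap.pi fun i => d i ∘ₗ LinearMap.proj i

omit [DecidableEq I] in
@[simp]
theorem diagMap_apply (d : ∀ i, A i →ₗ[ℂ] B i) (w : Π i, A i) (i : I) :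
    diagMap d w i = d i (w i) := rfl

theorem blockMap_ext [Finite I] {f g : (Π i, A i) →ₗ[ℂ] Π i, B i}
    (h : ∀ i j, blockEntry f i j = blockEntry g i j) : f = g :=
  LinearMap.pi_ext fun j v => funext fun i => congr($(h i j) v)

@[simp]
theorem blockEntry_blockMap [Fintype I] (m : ∀ i j, A j →ₗ[ℂ] B i) (i j : I) :
    blockEntry (blockMap m) i j = m i j := by
  ext v
  simp only [blockEntry, blockMap, LinearMap.comp_apply, LinearMap.proj_apply, LinearMap.pi_apply,
    LinearMap.sum_apply, LinearMap.single_apply]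
  rw [Finset.sum_eq_single j]
  · rw [Pi.single_eq_same]
  · intro k _ hk
    rw [Pi.single_eq_of_ne hk, map_zero]
  · simp

theorem blockEntry_comp [Fintype I] (f : (Π i, B i) →ₗ[ℂ] Π i, C i) (g : (Π i, A i) →ₗ[ℂ] Π i, B i)
    (i k : I) : blockEntry (f ∘ₗ g) i k = ∑ j, blockEntry f i j ∘ₗ blockEntry g j k := by
  ext v
  simp only [blockEntry, LinearMap.comp_apply, LinearMap.proj_apply, LinearMap.sum_apply,
    LinearMap.single_apply]
  conv_lhs => rw [← Finset.univ_sum_single (g (Pi.single k v))]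
  rw [map_sum, Finset.sum_apply]

theorem blockEntry_diagMap_comp (d : ∀ i, B i →ₗ[ℂ] C i) (f : (Π i, A i) →ₗ[ℂ] Π i, B i)
    (i j : I) : blockEntry (diagMap d ∘ₗ f) i j = d i ∘ₗ blockEntry f i j := rfl

theorem blockEntry_comp_diagMap (f : (Π i, B i) →ₗ[ℂ] Π i, C i) (d : ∀ i, A i →ₗ[ℂ] B i)
    (i j : I) : blockEntry (f ∘ₗ diagMap d) i j = blockEntry f i j ∘ₗ d j := by
  ext v
  refine congrArg (fun w => f w i) (funext fun k => ?_)
  by_cases hk : k = j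
  · subst hk
    simp
  · simp [hk]

theorem blockEntry_diagMap_self (d : ∀ i, A i →ₗ[ℂ] B i) (i : I) :
    blockEntry (diagMap d) i i = d i := by
  ext v
  simp [blockEntry]

theorem blockEntry_diagMap_of_ne (d : ∀ i, A i →ₗ[ℂ] B i) {i j : I} (h : i ≠ j) :
    blockEntry (diagMap d) i j = 0 := by
  ext v
  simp [blockEntry, h]

@[simp]
theorem blockEntry_sub (f g : (Π i, A i) →ₗ[ℂ] Π i, B i) (i j : I) :
    blockEntry (f - g) i j = blockEntry f i j - blockEntry g i j := rfl

@[simp]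
theorem blockEntry_zero (i j : I) : blockEntry (0 : (Π i, A i) →ₗ[ℂ] Π i, B i) i j = 0 := rfl

end BlockMaps

section TensorFactors

variable {P Q V V' : Type*} [AddCommGroup P] [Module ℂ P] [AddCommGroup Q] [Module ℂ Q]
  [AddCommGroup V] [Module ℂ V] [AddCommGroup V'] [Module ℂ V']

/-- Contraction of the second factor with a linear functional. -/
def contractSnd (Q : Type*) [AddCommGroup Q] [Module ℂ Q] (l : Module.Dual ℂ V) :
    Q ⊗[ℂ] V →ₗ[ℂ] Q :=
  (TensorProduct.rid ℂ Q).toLinearMap ∘ₗ l.lTensor Q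

@[simp]
theorem contractSnd_tmul (l : Module.Dual ℂ V) (q : Q) (v : V) :
    contractSnd Q l (q ⊗ₜ v) = l v • q := by
  simp [contractSnd]

theorem contractSnd_map (l : Module.Dual ℂ V') (f : P →ₗ[ℂ] Q) (z : P ⊗[ℂ] V') :
    contractSnd Q l (TensorProduct.map f LinearMap.id z) = f (contractSnd P l z) := by
  induction z with
  | zero => simp
  | add x y hx hy => simp only [map_add, hx, hy]
  | tmul p v => simp

theorem contractSnd_separates {z z' : Q ⊗[ℂ] V}
    (h : ∀ l, contractSnd Q l z = contractSnd Q l z') : z = z' := by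
  classical
  let b := Module.Basis.ofVectorSpace ℂ V
  apply (TensorProduct.equivFinsuppOfBasisRight b).injective
  ext j
  have key (y : Q ⊗[ℂ] V) :
      TensorProduct.equivFinsuppOfBasisRight b y j = contractSnd Q (b.coord j) y := by
    induction y with
    | zero => simp
    | add x y hx hy => simp only [map_add, Finsupp.add_apply, hx, hy]
    | tmul p v => simp
  rw [key, key, h]

theorem exists_dual_map_eq_one {q : Q} (hq : q ≠ 0) : ∃ l : Module.Dual ℂ Q, l q = 1 := by
  obtain ⟨l, hl⟩ := Module.Projective.exists_dual_ne_zero ℂ hq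
  exact ⟨(l q)⁻¹ • l, by simp [hl]⟩

theorem tensor_map_right_injective {h : P →ₗ[ℂ] Q} (hh : h ≠ 0) {x y : V →ₗ[ℂ] V'}
    (hxy : TensorProduct.map h x = TensorProduct.map h y) : x = y := by
  obtain ⟨p, hp⟩ : ∃ p, h p ≠ 0 := by
    by_contra! h0
    exact hh (LinearMap.ext h0)
  obtain ⟨l, hl⟩ := exists_dual_map_eq_one hp
  ext v
  have := congr(TensorProduct.lid ℂ V' (l.rTensor V' ($hxy (p ⊗ₜ v))))
  simpa [hl] using this

/-- Each matrix coefficient of the family `F` in the second factors is a multiple of the family `h`,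
by a scalar common to all `t`; these scalars are the matrix coefficients of `x`. The index `t`
ranges over the two coordinates for equivariant pairs, and over one point for intertwiners. -/
theorem exists_eq_tensor_map {T : Type*} (h : T → P →ₗ[ℂ] Q)
    (F : T → P ⊗[ℂ] V →ₗ[ℂ] Q ⊗[ℂ] V')
    (hF : ∀ (v : V) (l : Module.Dual ℂ V'), ∃ c : ℂ, ∀ t p,
      contractSnd Q l (F t (p ⊗ₜ v)) = c • h t p) :
    ∃ x : V →ₗ[ℂ] V', ∀ t, F t = TensorProduct.map (h t) x := by
  by_cases h0 : ∀ t p, h t p = 0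
  · refine ⟨0, fun t => TensorProduct.ext' fun p v => contractSnd_separates fun l => ?_⟩
    obtain ⟨c, hc⟩ := hF v l
    simp [hc, h0]
  · push Not at h0
    obtain ⟨t₀, p₀, hp⟩ := h0
    obtain ⟨m, hm⟩ := exists_dual_map_eq_one hp
    -- As `m (h t₀ p₀) = 1`, contracting `F t₀ (p₀ ⊗ v)` with `m` in the first factor recovers `x
    -- v`.
    refine ⟨(TensorProduct.lid ℂ V').toLinearMap ∘ₗ m.rTensor V' ∘ₗ F t₀ ∘ₗ
      TensorProduct.mk ℂ P V p₀,
      fun t => TensorProduct.ext' fun p v => contractSnd_separates fun l => ?_⟩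
    obtain ⟨c, hc⟩ := hF v l
    have key (z : Q ⊗[ℂ] V') :
        l (TensorProduct.lid ℂ V' (m.rTensor V' z)) = m (contractSnd Q l z) := by
      induction z with
      | zero => simp
      | add x y hx hy => simp only [map_add, hx, hy]
      | tmul q v => simp [mul_comm]
    simp [key, hc, hm]

end TensorFactors

section Slices

variable {P Q V V' : Type*} [AddCommGroup P] [Module ℂ P] [AddCommGroup Q] [Module ℂ Q]
  [AddCommGroup V] [Module ℂ V] [AddCommGroup V'] [Module ℂ V']

/-- The matrix coefficient, on the second factors, of a linear map between tensor products. -/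
def slice (l : Module.Dual ℂ V') (v : V) : (P ⊗[ℂ] V →ₗ[ℂ] Q ⊗[ℂ] V') →ₗ[ℂ] P →ₗ[ℂ] Q where
  toFun F := contractSnd Q l ∘ₗ F ∘ₗ (TensorProduct.mk ℂ P V).flip v
  map_add' F F' := by ext p; simp
  map_smul' c F := by ext p; simp

theorem slice_map_comp (l : Module.Dual ℂ V') (v : V) (s : Q →ₗ[ℂ] Q)
    (F : P ⊗[ℂ] V →ₗ[ℂ] Q ⊗[ℂ] V') :
    slice l v (TensorProduct.map s LinearMap.id ∘ₗ F) = s ∘ₗ slice l v F :=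
  LinearMap.ext fun _ => contractSnd_map ..

theorem slice_comp_map (l : Module.Dual ℂ V') (v : V) (r : P →ₗ[ℂ] P)
    (F : P ⊗[ℂ] V →ₗ[ℂ] Q ⊗[ℂ] V') :
    slice l v (F ∘ₗ TensorProduct.map r LinearMap.id) = slice l v F ∘ₗ r := rfl

end Slices

/-! ### Double representations and operators on `⨁ π i ⊗ V i`. -/

namespace DoubleRep

variable {I : Type*} {Γ : SimpleGraph I} [Γ.LocallyFinite] {ε : I → I → ℤˣ}

open Classical in
/-- The operator between the spaces at two vertices, zero if they are not joined. -/
def op (M : DoubleRep Γ ε) (i j : I) : M.V j →ₗ[ℂ] M.V i :=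
  if h : Γ.Adj i j then M.x i j h else 0

theorem op_of_adj (M : DoubleRep Γ ε) {i j : I} (h : Γ.Adj i j) : M.op i j = M.x i j h :=
  dif_pos h

theorem op_of_not_adj (M : DoubleRep Γ ε) {i j : I} (h : ¬Γ.Adj i j) : M.op i j = 0 :=
  dif_neg h

variable [Fintype I]

theorem sum_neighborSet {V : I → Type*} [∀ i, AddCommGroup (V i)] [∀ i, Module ℂ (V i)]
    {y : ∀ i j, V j →ₗ[ℂ] V i} (hy : ∀ i j, ¬Γ.Adj i j → y i j = 0) (i : I) :
    ∑ j : Γ.neighborSet i, ε i j • (y i j ∘ₗ y j i) = ∑ j, ε i j • (y i j ∘ₗ y j i) := by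
  refine Fintype.sum_of_injective Subtype.val Subtype.val_injective _ _ (fun j hj => ?_)
    fun j => rfl
  rw [hy i j fun h => hj ⟨⟨j, h⟩, rfl⟩, LinearMap.zero_comp, smul_zero]

theorem sum_op (M : DoubleRep Γ ε) (i : I) : ∑ j, ε i j • (M.op i j ∘ₗ M.op j i) = 0 := by
  rw [← sum_neighborSet fun _ _ => M.op_of_not_adj, ← M.relation i]
  exact Finset.sum_congr rfl fun j _ => by rw [M.op_of_adj j.2, M.op_of_adj j.2.symm]

end DoubleRep

section TensorModules

variable {I : Type*} [Fintype I] {G : Subgroup SL(2, ℂ)} {Γ : SimpleGraph I}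
  {ε : I → I → ℤˣ} {π : I → FDRep ℂ G} (S : SpanningPairs Γ ε π) {V : I → Type*}
  [∀ i, AddCommGroup (V i)] [∀ i, Module ℂ (V i)]

namespace SpanningPairs

/-- The action of the coordinates of `ℂ²` given by a family of operators. -/
def coord (y : ∀ i j, V j →ₗ[ℂ] V i) (a : Fin 2) :
    (Π i, π i ⊗[ℂ] V i) →ₗ[ℂ] Π i, π i ⊗[ℂ] V i :=
  blockMap fun i j => TensorProduct.map (S.φ i j a) (y i j)

theorem blockEntry_coord [DecidableEq I] (y : ∀ i j, V j →ₗ[ℂ] V i) (a : Fin 2) (i j : I) :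
    blockEntry (S.coord y a) i j = TensorProduct.map (S.φ i j a) (y i j) :=
  blockEntry_blockMap ..

theorem blockEntry_commutator [DecidableEq I] (y : ∀ i j, V j →ₗ[ℂ] V i) (i k : I) :
    blockEntry (S.coord y 0 ∘ₗ S.coord y 1 - S.coord y 1 ∘ₗ S.coord y 0) i k =
      ∑ j, TensorProduct.map (bracket (S.φ i j) (S.φ j k)) (y i j ∘ₗ y j k) := by
  simp only [blockEntry_sub, blockEntry_comp, blockEntry_coord, ← Finset.sum_sub_distrib, bracket,
    ← TensorProduct.map_comp]
  exact Finset.sum_congr rfl fun j _ => congr($(map_sub (TensorProduct.mapBilinear (RingHom.id ℂ)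
    (π k) (V k) (π i) (V i)) _ _) _).symm

theorem blockEntry_commutator_self [DecidableEq I] {y : ∀ i j, V j →ₗ[ℂ] V i}
    (hy : ∀ i j, ¬Γ.Adj i j → y i j = 0) (i : I) :
    blockEntry (S.coord y 0 ∘ₗ S.coord y 1 - S.coord y 1 ∘ₗ S.coord y 0) i i =
      TensorProduct.map LinearMap.id (S.κ i • ∑ j, ε i j • (y i j ∘ₗ y j i)) := by
  rw [blockEntry_commutator, Finset.smul_sum, ← TensorProduct.mapBilinear_apply (R := ℂ), map_sum]
  refine Finset.sum_congr rfl fun j _ => ?_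
  rw [TensorProduct.mapBilinear_apply]
  by_cases h : Γ.Adj i j
  · rw [S.bracket_self i j h, Units.smul_def, Units.smul_def, ← Int.cast_smul_eq_zsmul ℂ,
      ← Int.cast_smul_eq_zsmul ℂ]
    simp only [TensorProduct.map_smul_left, TensorProduct.map_smul_right]
  · rw [hy i j h]
    simp

/-- Off the diagonal the blocks of the commutator vanish, by Schur. The diagonal block at `i` is the
identity of `π i` tensored with `κ i` times the left side of the relation at `i`; both factors
cancel, as `π i` and `κ i` are nonzero. -/
theorem commute_iff (hπ : ∀ i, Nontrivial (π i)) {y : ∀ i j, V j →ₗ[ℂ] V i}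
    (hy : ∀ i j, ¬Γ.Adj i j → y i j = 0) :
    S.coord y 0 ∘ₗ S.coord y 1 = S.coord y 1 ∘ₗ S.coord y 0 ↔
      ∀ i, ∑ j, ε i j • (y i j ∘ₗ y j i) = 0 := by
  classical
  rw [← sub_eq_zero]
  refine ⟨fun h i => ?_, fun h => blockMap_ext fun i k => ?_⟩
  · have h' := S.blockEntry_commutator_self hy i
    rw [h, blockEntry_zero] at h'
    refine (smul_eq_zero.1 (tensor_map_right_injective (P := π i) (Q := π i) (h := LinearMap.id)
      ?_ (h'.symm.trans (TensorProduct.map_zero_right _).symm))).resolve_left (S.κ_ne_zero i)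
    exact one_ne_zero (α := Module.End ℂ (π i))
  · by_cases hik : i = k
    · subst hik
      rw [S.blockEntry_commutator_self hy, h, smul_zero, TensorProduct.map_zero_right,
        blockEntry_zero]
    · rw [blockEntry_commutator, blockEntry_zero]
      exact Finset.sum_eq_zero fun j _ => by
        rw [S.bracket_of_ne i j k hik, TensorProduct.map_zero_left]

end SpanningPairs

variable (π V) in
/-- The action of `G` on a sum of irreducible representations, with multiplicity spaces. -/
def isotypicRep : Representation ℂ G (Π i, π i ⊗[ℂ] V i) where
  toFun g := diagMap fun i => TensorProduct.map ((π i).ρ g) LinearMap.id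
  map_one' := by
    refine LinearMap.ext fun w => funext fun i => ?_
    simp [Module.End.one_eq_id]
  map_mul' g h := by
    refine LinearMap.ext fun w => funext fun i => ?_
    rw [diagMap_apply, map_mul, Module.End.mul_eq_comp, ← LinearMap.id_comp (LinearMap.id (M := V i)),
      TensorProduct.map_comp]
    rfl

omit [Fintype I] in
theorem isotypicRep_apply (g : G) : isotypicRep π V g =
    diagMap fun i => TensorProduct.map ((π i).ρ g) LinearMap.id := rfl

theorem SpanningPairs.coord_mem (y : ∀ i j, V j →ₗ[ℂ] V i) :
    S.coord y ∈ equivariantPairs (isotypicRep π V) (isotypicRep π V) := by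
  classical
  refine fun g a => blockMap_ext fun i j => ?_
  have h := S.mem i j g a
  rw [Fin.sum_univ_two] at h ⊢
  have hadd (f f' : (Π i, π i ⊗[ℂ] V i) →ₗ[ℂ] Π i, π i ⊗[ℂ] V i) (c c' : ℂ) :
    blockEntry (c • f + c' • f') i j = c • blockEntry f i j + c' • blockEntry f' i j := rfl
  rw [hadd, isotypicRep_apply, blockEntry_diagMap_comp, blockEntry_comp_diagMap,
    blockEntry_comp_diagMap, S.blockEntry_coord, S.blockEntry_coord, S.blockEntry_coord,
    ← TensorProduct.map_comp, ← TensorProduct.map_comp, ← TensorProduct.map_comp,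
    LinearMap.id_comp, LinearMap.comp_id, h, TensorProduct.map_add_left,
    TensorProduct.map_smul_left, TensorProduct.map_smul_left]

omit [Fintype I] in
theorem piScalarRight_map_id {ι Q : Type*} [Fintype ι] [DecidableEq ι] [AddCommGroup Q] [Module ℂ Q]
    (s : Q →ₗ[ℂ] Q) (z : Q ⊗[ℂ] (ι → ℂ)) (k : ι) :
    TensorProduct.piScalarRight ℂ ℂ Q ι (TensorProduct.map s LinearMap.id z) k =
      s (TensorProduct.piScalarRight ℂ ℂ Q ι z k) := by
  induction z with
  | zero => simp
  | add x y hx hy => simp only [map_add, Pi.add_apply, hx, hy]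
  | tmul q v => simp

omit [Fintype I] in
theorem exists_equiv_isotypic [Finite G] (hπ : ∀ ρ : FDRep ℂ G, Simple ρ → ∃ i, Nonempty (ρ ≅ π i))
    {W : Type} [AddCommGroup W] [Module ℂ W] [FiniteDimensional ℂ W] (σ : Representation ℂ G W) :
    ∃ (T : I → Type) (_ : ∀ i, Finite (T i)) (e : W ≃ₗ[ℂ] Π i, π i ⊗[ℂ] (T i → ℂ)),
      ∀ g w, e (σ g w) = isotypicRep π (fun i => T i → ℂ) g (e w) := by
  classical
  obtain ⟨n, idx, e, he⟩ := exists_equiv_pi π hπ σ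
  -- The multiplicity space of `π i` consists of the functions on the set of summands isomorphic to
  -- it.
  let T (i : I) : Type := {k // idx k = i}
  let B : (Π i, π i ⊗[ℂ] (T i → ℂ)) →ₗ[ℂ] Π k, π (idx k) := LinearMap.pi fun k =>
    LinearMap.proj (⟨k, rfl⟩ : T (idx k)) ∘ₗ
      (TensorProduct.piScalarRight ℂ ℂ (π (idx k)) (T (idx k))).toLinearMap ∘ₗ
      LinearMap.proj (idx k)
  have hB (w) (k) : B w k = TensorProduct.piScalarRight ℂ ℂ (π (idx k)) (T (idx k)) (w (idx k))
    ⟨k, rfl⟩ := rfl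
  have hbij : Function.Bijective B := by
    constructor
    · intro w w' h
      refine funext fun i => (TensorProduct.piScalarRight ℂ ℂ (π i) (T i)).injective
        (funext ?_)
      rintro ⟨k, rfl⟩
      exact congrFun h k
    · intro u
      refine ⟨fun i => (TensorProduct.piScalarRight ℂ ℂ (π i) (T i)).symm fun s => s.2 ▸ u s.1,
        funext fun k => ?_⟩
      rw [hB, LinearEquiv.apply_symm_apply]
  let E := LinearEquiv.ofBijective B hbij
  refine ⟨T, fun i => inferInstance, e.trans E.symm, fun g w => ?_⟩
  obtain ⟨w', hw⟩ := E.surjective (e w)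
  rw [LinearEquiv.trans_apply, LinearEquiv.trans_apply, ← hw, E.symm_apply_apply,
    E.symm_apply_eq]
  refine funext fun k => ?_
  rw [he, ← hw]
  change (π (idx k)).ρ g (B w' k) = B _ k
  rw [hB, hB, isotypicRep_apply, diagMap_apply]
  exact (piScalarRight_map_id _ _ _).symm

end TensorModules

/-! ### The equivalence between double representations and skew modules. -/

namespace SpanningPairs

variable {I : Type w} [Fintype I] {G : Subgroup SL(2, ℂ)} {Γ : SimpleGraph I} [Γ.LocallyFinite]
  {ε : I → I → ℤˣ} {π : I → FDRep ℂ G} (S : SpanningPairs Γ ε π)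

/-- The module over the skew group algebra attached to a double representation. -/
def toSkewModule (hπ : ∀ i, Nontrivial (π i)) : DoubleRep Γ ε ⥤ SkewModule.{w} G where
  obj M :=
    { W := Π i, π i ⊗[ℂ] M.V i
      ρ := isotypicRep π M.V
      X := S.coord M.op
      commute := (S.commute_iff hπ fun _ _ => M.op_of_not_adj).2 M.sum_op
      equivariant := S.coord_mem M.op }
  map {M N} f :=
    { lin := diagMap fun i => TensorProduct.map LinearMap.id (f.map i)
      comm_ρ g := by
        refine LinearMap.ext fun z => funext fun i => ?_
        simp only [isotypicRep_apply, LinearMap.comp_apply, diagMap_apply,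
          TensorProduct.map_map, LinearMap.id_comp, LinearMap.comp_id]
      comm_X a := by
        classical
        refine blockMap_ext fun i j => ?_
        rw [blockEntry_diagMap_comp, blockEntry_comp_diagMap, blockEntry_coord, blockEntry_coord,
          ← TensorProduct.map_comp, ← TensorProduct.map_comp, LinearMap.id_comp, LinearMap.comp_id]
        by_cases h : Γ.Adj i j
        · rw [M.op_of_adj h, N.op_of_adj h, f.comm]
        · rw [S.eq_zero i j h, Pi.zero_apply, TensorProduct.map_zero_left,
            TensorProduct.map_zero_left] }
  map_id M := by
    refine SkewModule.hom_ext (LinearMap.ext fun z => funext fun i => ?_)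
    exact congr($TensorProduct.map_id (z i))
  map_comp f g := by
    refine SkewModule.hom_ext (LinearMap.ext fun z => funext fun i => ?_)
    simp [TensorProduct.map_map]

variable (hπ : ∀ i, Nontrivial (π i))

theorem toSkewModule_map_lin {M N : DoubleRep Γ ε} (f : M ⟶ N) :
    ((S.toSkewModule hπ).map f).lin =
      diagMap fun i => TensorProduct.map LinearMap.id (f.map i) := rfl

instance : (S.toSkewModule hπ).Additive where
  map_add {M N f g} := by
    refine SkewModule.hom_ext (LinearMap.ext fun z => funext fun i => ?_)
    exact congr($(TensorProduct.map_add_right _ _ _) (z i))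

instance : (S.toSkewModule hπ).Linear ℂ where
  map_smul {M N} f c := by
    refine SkewModule.hom_ext (LinearMap.ext fun z => funext fun i => ?_)
    exact congr($(TensorProduct.map_smul_right _ _ _) (z i))

instance : (S.toSkewModule hπ).Faithful where
  map_injective {M N f g} h := by
    classical
    ext1 i
    refine tensor_map_right_injective (P := π i) (Q := π i) (h := LinearMap.id)
      (one_ne_zero (α := Module.End ℂ (π i))) ?_
    have h' := congr(blockEntry $(congrArg SkewModule.Hom.lin h) i i)
    rwa [toSkewModule_map_lin, toSkewModule_map_lin, blockEntry_diagMap_self,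
      blockEntry_diagMap_self] at h'

-- The group acts only on the first tensor factors, so matrix coefficients in the second factors
-- inherit equivariance. This brings Schur's lemma to bear on single blocks.
omit [Γ.LocallyFinite] [Fintype I] in
theorem slice_blockEntry_mem_intertwiners [DecidableEq I] {V V' : I → Type*}
    [∀ i, AddCommGroup (V i)] [∀ i, Module ℂ (V i)] [∀ i, AddCommGroup (V' i)]
    [∀ i, Module ℂ (V' i)] {f : (Π i, π i ⊗[ℂ] V i) →ₗ[ℂ] Π i, π i ⊗[ℂ] V' i}
    (hf : ∀ g, f ∘ₗ isotypicRep π V g = isotypicRep π V' g ∘ₗ f) (i j : I)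
    (l : Module.Dual ℂ (V' i)) (v : V j) :
    slice l v (blockEntry f i j) ∈ intertwiners (π j).ρ (π i).ρ := by
  intro g
  have h := congr(slice l v (blockEntry $(hf g) i j))
  rwa [isotypicRep_apply, isotypicRep_apply, blockEntry_diagMap_comp, blockEntry_comp_diagMap,
    slice_map_comp, slice_comp_map] at h

/-- By Schur, a `G`-map between the sums is block diagonal with blocks `id ⊗ x i`. Commutation with
the coordinates then gives commutation of the `x i` with the edge operators, since a nonzero
component of `φ i j` can be cancelled. -/
theorem toSkewModule_full [∀ i, Simple (π i)] (hinj : ∀ i j, Nonempty (π i ≅ π j) → i = j) :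
    (S.toSkewModule hπ).Full where
  map_surjective {M N} f := by
    classical
    have hmem := slice_blockEntry_mem_intertwiners f.comm_ρ
    have hdiag (i : I) : ∃ x : M.V i →ₗ[ℂ] N.V i,
        blockEntry f.lin i i = TensorProduct.map LinearMap.id x := by
      obtain ⟨x, hx⟩ := exists_eq_tensor_map (fun _ : Unit => LinearMap.id (R := ℂ) (M := π i))
        (fun _ => blockEntry f.lin i i) fun v l => by
          obtain ⟨c, hc⟩ := exists_eq_smul_id_of_mem_intertwiners _ (hmem i i l v)
          exact ⟨c, fun _ p => congr($hc p)⟩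
      exact ⟨x, hx ()⟩
    choose x hx using hdiag
    have hf : f.lin = diagMap fun i => TensorProduct.map LinearMap.id (x i) := by
      refine blockMap_ext fun i j => ?_
      by_cases h : i = j
      · subst h
        rw [hx, blockEntry_diagMap_self]
      · rw [blockEntry_diagMap_of_ne _ h]
        refine TensorProduct.ext' fun p v => contractSnd_separates fun l => ?_
        have h0 := eq_zero_of_mem_intertwiners _ _ (fun h' => h (hinj _ _ h').symm) (hmem i j l v)
        exact congr($h0 p).trans (map_zero (contractSnd (π i) l)).symm
    refine ⟨⟨x, fun i j h => ?_⟩, SkewModule.hom_ext hf.symm⟩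
    obtain ⟨a, ha⟩ := Function.ne_iff.1 (S.ne_zero i j h)
    refine tensor_map_right_injective ha ?_
    have hc : (diagMap fun i => TensorProduct.map LinearMap.id (x i)) ∘ₗ S.coord M.op a =
        S.coord N.op a ∘ₗ diagMap fun i => TensorProduct.map LinearMap.id (x i) :=
      (congrArg (· ∘ₗ S.coord M.op a) hf.symm).trans
        ((f.comm_X a).trans (congrArg (S.coord N.op a ∘ₗ ·) hf))
    have h' := congr(blockEntry $hc i j)
    rwa [blockEntry_diagMap_comp, blockEntry_comp_diagMap, blockEntry_coord, blockEntry_coord,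
      ← TensorProduct.map_comp, ← TensorProduct.map_comp, LinearMap.id_comp, LinearMap.comp_id,
      M.op_of_adj h, N.op_of_adj h] at h'

-- Every matrix coefficient of a block of `X` is an equivariant pair `π j → π i`, hence a multiple
-- of `φ i j`; both components share the multiple, so one operator `y i j` serves them.
omit [Γ.LocallyFinite] in
theorem exists_eq_coord {V : I → Type*} [∀ i, AddCommGroup (V i)] [∀ i, Module ℂ (V i)]
    {X : Fin 2 → (Π i, π i ⊗[ℂ] V i) →ₗ[ℂ] Π i, π i ⊗[ℂ] V i}
    (hX : X ∈ equivariantPairs (isotypicRep π V) (isotypicRep π V)) :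
    ∃ y : ∀ i j, V j →ₗ[ℂ] V i, (∀ i j, ¬Γ.Adj i j → y i j = 0) ∧ X = S.coord y := by
  classical
  have hmem (i j : I) (l : Module.Dual ℂ (V i)) (v : V j) :
      (fun a => slice l v (blockEntry (X a) i j)) ∈ equivariantPairs (π j).ρ (π i).ρ := by
    intro g a
    have h := hX g a
    rw [Fin.sum_univ_two] at h ⊢
    have h' := congr(slice l v (blockEntry $h i j))
    have hadd (f f' : (Π i, π i ⊗[ℂ] V i) →ₗ[ℂ] Π i, π i ⊗[ℂ] V i) (c c' : ℂ) :
      blockEntry (c • f + c' • f') i j = c • blockEntry f i j + c' • blockEntry f' i j := rfl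
    rwa [hadd, map_add, map_smul, map_smul, isotypicRep_apply, blockEntry_diagMap_comp,
      blockEntry_comp_diagMap, blockEntry_comp_diagMap, slice_map_comp, slice_comp_map,
      slice_comp_map] at h'
  have hex (i j : I) : ∃ y : V j →ₗ[ℂ] V i, (¬Γ.Adj i j → y = 0) ∧
      ∀ a, blockEntry (X a) i j = TensorProduct.map (S.φ i j a) y := by
    obtain ⟨y, hy⟩ := exists_eq_tensor_map (S.φ i j) (fun a => blockEntry (X a) i j)
      fun v l => by
        obtain ⟨c, hc⟩ := S.span i j _ (hmem i j l v)
        exact ⟨c, fun a p => congr($hc a p)⟩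
    by_cases h : Γ.Adj i j
    · exact ⟨y, fun h' => absurd h h', hy⟩
    · refine ⟨0, fun _ => rfl, fun a => ?_⟩
      rw [hy, S.eq_zero i j h, Pi.zero_apply, TensorProduct.map_zero_left,
        TensorProduct.map_zero_left]
  choose y hy hXy using hex
  refine ⟨y, hy, funext fun a => blockMap_ext fun i j => ?_⟩
  rw [hXy, blockEntry_coord]

theorem toSkewModule_essSurj [Finite G]
    (hsurj : ∀ ρ : FDRep ℂ G, Simple ρ → ∃ i, Nonempty (ρ ≅ π i)) :
    (S.toSkewModule hπ).EssSurj where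
  mem_essImage N := by
    -- The passage to `ℂⁿ` lowers the universe, as the decomposition into irreducibles is stated in
    -- `Type`.
    let e₁ := (Module.finBasis ℂ N.W).equivFun
    obtain ⟨T, hT, e₂, he₂⟩ := exists_equiv_isotypic hsurj (N.transport e₁).ρ
    let e : N.W ≃ₗ[ℂ] Π i, π i ⊗[ℂ] (T i → ℂ) := e₁.trans e₂
    have he (g : G) (z : N.W) : e (N.ρ g z) = isotypicRep π (fun i => T i → ℂ) g (e z) :=
      (congrArg e₂ (N.transport_ρ_apply e₁ g z).symm).trans (he₂ g (e₁ z))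
    have hρ : (N.transport e).ρ = isotypicRep π (fun i => T i → ℂ) := by
      refine MonoidHom.ext fun g => LinearMap.ext fun z => ?_
      obtain ⟨z, rfl⟩ := e.surjective z
      exact (N.transport_ρ_apply e g z).trans (he g z)
    have hX := (N.transport e).equivariant
    rw [hρ] at hX
    obtain ⟨y, hy, hXy⟩ := S.exists_eq_coord hX
    have hrel := (S.commute_iff hπ hy).1 (by rw [← hXy]; exact (N.transport e).commute)
    let M : DoubleRep Γ ε :=
      { V i := T i → ℂ
        x i j _ := y i j
        relation i := (DoubleRep.sum_neighborSet hy i).trans (hrel i) }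
    have hop : M.op = y := by
      funext i j
      by_cases h : Γ.Adj i j
      · rw [M.op_of_adj h]
      · rw [M.op_of_not_adj h, hy i j h]
    refine ⟨M, ⟨SkewModule.isoMk e.symm (fun g z => ?_) fun a z => ?_⟩⟩
    · obtain ⟨z, rfl⟩ := e.surjective z
      exact (e.symm_apply_eq.2 (he g z).symm).trans
        (congrArg (N.ρ g) (e.symm_apply_apply z).symm)
    · obtain ⟨z, rfl⟩ := e.surjective z
      have hMX : S.coord M.op = (N.transport e).X := by rw [hop, hXy]
      exact (e.symm_apply_eq.2 (congr($hMX a (e z)).trans (N.transport_X_apply e a z))).trans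
        (congrArg (N.X a) (e.symm_apply_apply z).symm)

end SpanningPairs

/-! ### Assembly of the equivalences and choice of signs. -/

theorem IsMcKayGraph.exists_equivalence {G : Subgroup SL(2, ℂ)} [Finite G] {I : Type*} [Fintype I]
    {Γ : SimpleGraph I} [DecidableRel Γ.Adj] {π : I → FDRep ℂ G} (hΓ : IsMcKayGraph G Γ π)
    (ε : I → I → ℤˣ) (u : I → ℤˣ) (hε : ∀ i j, Γ.Adj i j → u i * ε i j = -(u j * ε j i)) :
    ∃ e : DoubleRep Γ ε ≌ CohPlane G, e.functor.Additive ∧ e.functor.Linear ℂ := by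
  obtain ⟨S⟩ := exists_spanningPairs hΓ ε u hε
  have := hΓ.simple
  have hπ (i : I) : Nontrivial (π i) := FDRep.nontrivial_of_simple (π i)
  let F := S.toSkewModule hπ
  have hfull : F.Full := S.toSkewModule_full hπ hΓ.injective
  have hess : F.EssSurj := S.toSkewModule_essSurj hπ hΓ.surjective
  have hF : F.IsEquivalence := { }
  -- The sum over the vertices lives in the universe of `I`, whereas global sections are in `Type`;
  -- the lift reconciles them.
  let E := (globalSections G ⋙ SkewModule.uliftFunctor G).asEquivalence
  have : E.functor.Additive :=
    inferInstanceAs (globalSections G ⋙ SkewModule.uliftFunctor G).Additive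
  have : E.functor.Linear ℂ :=
    inferInstanceAs ((globalSections G ⋙ SkewModule.uliftFunctor G).Linear ℂ)
  have : E.inverse.Additive := E.inverse_additive
  have : E.inverse.Linear ℂ := E.inverseLinear ℂ
  exact ⟨F.asEquivalence.trans E.symm, inferInstanceAs (F ⋙ E.inverse).Additive,
    inferInstanceAs ((F ⋙ E.inverse).Linear ℂ)⟩

end

theorem proposition3p4 (G : Subgroup SL(2, ℂ)) [Finite G] {I : Type*} [Fintype I]
    (Γ : SimpleGraph I) [DecidableRel Γ.Adj] (π : I → FDRep ℂ G) (hΓ : IsMcKayGraph G Γ π) :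
    (∀ ε : I → I → ℤˣ, (∀ i j, Γ.Adj i j → ε i j = -ε j i) →
      ∃ e : DoubleRep Γ ε ≌ CohPlane G, e.functor.Additive ∧ e.functor.Linear ℂ) ∧
    (Γ.IsBipartite →
      ∃ e : DoubleRep Γ (fun _ _ => 1) ≌ CohPlane G, e.functor.Additive ∧ e.functor.Linear ℂ) := by
  refine ⟨fun ε hε => hΓ.exists_equivalence ε 1 fun i j h => by simpa using hε i j h, ?_⟩
  rintro ⟨c⟩
  -- Adjacent vertices have different colours, so the signs of the two-colouring are opposite at the
  -- ends of every edge.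
  refine hΓ.exists_equivalence _ (fun i => if c i = 0 then 1 else -1) fun i j h => ?_
  have hc : c i ≠ c j := c.valid h
  have h2 (a b : Fin 2) (hab : a ≠ b) :
      (if a = 0 then 1 else -1 : ℤˣ) * 1 = -((if b = 0 then 1 else -1) * 1) := by
    revert a b
    decide
  exact h2 _ _ hc
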